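/- Let $Q$ be a star: $n\ge 2$ arcs of lengths $\lambda_1,\dots,\lambda_n>0$ joined at a common end point $O$ (the root), with its path metric $d$, and let $\mu=\sum_j\lambda_j$. A *hiding distribution* $h$ is a Borel probability measure on $Q$. A *search* is a function $S:[0,\infty)\to Q$ with $S(0)=O$ and $d(S(t_1),S(t_2))\le t_2-t_1$ for $0\le t_1<t_2$. Put $T(S,x)=\min\{t\ge 0: S(t)=x\}$ ($=\infty$ if $x$ is never reached) and $T(S,h)=\int_Q T(S,x)\,dh(x)$; a search is *optimal* against $h$ if it minimizes $T(\cdot,h)$ over all searches. A *depth-first* search tours the arcs one after the other in some order, traversing each at unit speed from $O$ to its leaf and back to $O$. The distribution $h$ is *simply searchable* if some depth-first search is optimal, and *strictly (strongly) simply searchable* if the only optimal searches are depth-first, where the behavior of a search after it has covered $Q$ is disregarded. The distribution $h$ is *balanced* if the ratio $h(Q_j\setminus\{O\})/\lambda_j$ is the same for all arcs $Q_j$. Let $F_j(x)=h(\{p\in Q_j: d(O,p)\le x\})$ and $h_j=F_j(\lambda_j)$. Then $h$ is *forward biased* if for every $j$ $$F_j(x)\le H_j(x):=\frac{x+(h_j\mu-\lambda_j)^+}{x+\mu-\lambda_j}\qquad\text{for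 all } 0\le x\le\lambda_j,$$ and *strictly forward biased* if moreover $F_j(x)<H_j(x)$ for all $j$ and all $0<x<\lambda_j$. (If $h$ is balanced and $h(\{O\})=0$, then $h_j=\lambda_j/\mu$ and $H_j(x)=x/(x+\mu-\lambda_j)$.) **Theorem.** Let $h$ be a balanced hiding distribution on a star. Then $h$ is simply searchable if and only if it is forward biased. Moreover, $h$ is strictly simply searchable if and only if it is strictly forward biased. -/

import Mathlib

open MeasureTheory
open scoped NNReal ENNReal

noncomputable section

/-- A star: at least two arcs of positive lengths, all joined at a common end point, the root. -/
structure StarNetwork where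
  /-- the number of arcs -/
  n : ℕ
  two_le_n : 2 ≤ n
  /-- the lengths of the arcs -/
  len : Fin n → ℝ
  len_pos : ∀ j, 0 < len j

namespace StarNetwork

/-- The points of the star. A point has one coordinate for each arc and at most one of them is
nonzero: the point on arc `j` at distance `r` from the root has `j`-th coordinate `r` and all other
coordinates `0`. The metric is the one induced by the `ℓ¹` norm, which is the path metric of the
star: it is `|r - s|` for two points of the same arc at distances `r`, `s` from the root, and
`r + s` for points on different arcs. The measurable sets are the Borel sets. -/
abbrev Point (Q : StarNetwork) : Type :=
  {p : PiLp 1 (fun _ : Fin Q.n => ℝ) //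
    (∀ j, 0 ≤ p j ∧ p j ≤ Q.len j) ∧ ∀ i j, i ≠ j → p i = 0 ∨ p j = 0}

/-- The root, the common end point of the arcs. -/
def root (Q : StarNetwork) : Q.Point :=
  ⟨0, fun j => ⟨le_refl (0 : ℝ), (Q.len_pos j).le⟩, fun _ _ _ => Or.inl rfl⟩

/-- The `j`-th arc, with both of its end points. -/
def arc (Q : StarNetwork) (j : Fin Q.n) : Set Q.Point :=
  {p | ∀ i, i ≠ j → p.1 i = 0}

/-- The total length of the star. -/
def totalLength (Q : StarNetwork) : ℝ := ∑ j, Q.len j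

/-- A search: a path on the star that starts at the root and satisfies
`dist (S t₁) (S t₂) ≤ |t₁ - t₂|` for all times. -/
structure Search (Q : StarNetwork) where
  path : ℝ≥0 → Q.Point
  start : path 0 = Q.root
  lipschitz : LipschitzWith 1 path

variable {Q : StarNetwork}

/-- The time at which `S` first reaches `p`; it is `∞` if `S` never reaches `p`. -/
def Search.time (S : Q.Search) (p : Q.Point) : ℝ≥0∞ :=
  ⨅ (t : ℝ≥0) (_ : S.path t = p), (t : ℝ≥0∞)

/-- The expected search time of `S` against the hiding distribution `h`. -/
def Search.expectedTime (S : Q.Search) (h : Measure Q.Point) : ℝ≥0∞ :=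
  ∫⁻ p, S.time p ∂h

/-- `S` minimizes the expected search time against `h`. -/
def Search.IsOptimal (S : Q.Search) (h : Measure Q.Point) : Prop :=
  ∀ S' : Q.Search, S.expectedTime h ≤ S'.expectedTime h

/-- The time at which the `k`-th tour of an arc starts, if the arcs are toured in the order
`σ 0, σ 1, …`. -/
def tourStart (σ : Equiv.Perm (Fin Q.n)) (k : Fin Q.n) : ℝ :=
  2 * ∑ i ∈ Finset.Iio k, Q.len (σ i)

/-- A depth-first search: the arcs are toured one after the other, in some order, each of them
traversed at unit speed from the root to its leaf and then back to the root. The search is back at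
the root at time `2 * Q.totalLength`; what it does later is not restricted. -/
def Search.IsDepthFirst (S : Q.Search) : Prop :=
  ∃ σ : Equiv.Perm (Fin Q.n), ∀ (k : Fin Q.n) (t : ℝ≥0),
    (tourStart σ k ≤ t → t ≤ tourStart σ k + Q.len (σ k) →
      S.path t ∈ Q.arc (σ k) ∧ dist Q.root (S.path t) = t - tourStart σ k) ∧
    (tourStart σ k + Q.len (σ k) ≤ t → t ≤ tourStart σ k + 2 * Q.len (σ k) →
      S.path t ∈ Q.arc (σ k) ∧
        dist Q.root (S.path t) = tourStart σ k + 2 * Q.len (σ k) - t)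

/-- `S` and `S'` coincide up to some time by which the whole star has been covered. -/
def Search.AgreeUntilCovered (S S' : Q.Search) : Prop :=
  ∃ M : ℝ≥0, S.path '' Set.Icc 0 M = Set.univ ∧ ∀ t ≤ M, S.path t = S'.path t

/-- Some depth-first search is optimal against `h`. -/
def SimplySearchable (h : Measure Q.Point) : Prop :=
  ∃ S : Q.Search, S.IsDepthFirst ∧ S.IsOptimal h

/-- The only optimal searches against `h` are the depth-first ones; the behavior of a search after
it has covered the star is disregarded. -/
def StronglySimplySearchable (h : Measure Q.Point) : Prop :=
  ∀ S : Q.Search, S.IsOptimal h → ∃ S' : Q.Search, S'.IsDepthFirst ∧ S.AgreeUntilCovered S'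

/-- The search density of the `j`-th branch at the root. The branches are the connected components
of the star without its root, that is, the arcs without the root. -/
def branchDensity (h : Measure Q.Point) (j : Fin Q.n) : ℝ :=
  h.real (Q.arc j \ {Q.root}) / Q.len j

/-- All branches at the root, which is the only branch node, have the same search density. -/
def Balanced (h : Measure Q.Point) : Prop :=
  ∀ i j : Fin Q.n, branchDensity h i = branchDensity h j

/-- `F_j(x)`: the probability that the target is on arc `j` at distance at most `x` from the
root. -/
def arcCdf (h : Measure Q.Point) (j : Fin Q.n) (x : ℝ) : ℝ :=
  h.real {p | p ∈ Q.arc j ∧ dist Q.root p ≤ x}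

/-- `H_j(x) = (x + (h_j μ - λ_j)⁺) / (x + μ - λ_j)`, where `h_j = F_j(λ_j)`. -/
def forwardBound (h : Measure Q.Point) (j : Fin Q.n) (x : ℝ) : ℝ :=
  (x + max (arcCdf h j (Q.len j) * Q.totalLength - Q.len j) 0) /
    (x + Q.totalLength - Q.len j)

/-- `F_j(x) ≤ H_j(x)` on every arc. -/
def ForwardBiased (h : Measure Q.Point) : Prop :=
  ∀ (j : Fin Q.n) (x : ℝ), 0 ≤ x → x ≤ Q.len j → arcCdf h j x ≤ forwardBound h j x

/-- Forward biased, with strict inequality in the interior of every arc. -/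
def StrictlyForwardBiased (h : Measure Q.Point) : Prop :=
  ForwardBiased h ∧
    ∀ (j : Fin Q.n) (x : ℝ), 0 < x → x < Q.len j → arcCdf h j x < forwardBound h j x

end StarNetwork

end

/-!
# Simply searchable distributions on a star

Let `ρ` be the common search density of the branches, `G_j x` the mass of the part of branch `j`
within distance `x` of the root (`near`), and `μ` the total length. The mass of the root is
`1 - ρ μ`, and the forward bias condition at `x` reads `G_j x * (x + μ - λ_j) ≤ ρ μ x`
(`arcCdf_le_iff`). Every depth-first search has expected time
`V = meanDist h + ρ * ∑_{i ≠ k} λ_i λ_k` (`Search.Follows.expectedTime_eq`).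

*Necessity.* Precede a depth-first search that tours arc `j` last by an excursion to distance `x` on
arc `j`. The expected time changes by `2 (ρ μ x - G_j x (x + μ - λ_j))` (`exists_last_prepend`), so
optimality of `V` forces the forward bound. If the bound is attained inside an arc, the new search
is optimal as well, but it is not depth-first. The strict statement also needs that an optimal
search exists, since strong simple searchability says nothing otherwise; this follows from the
Arzelà–Ascoli theorem, the lower semicontinuity of search times and Fatou's lemma
(`Search.exists_isOptimal`).

*Sufficiency.* An arbitrary search is cut at its visits to the root into countably many excursions,
indexed by their starting times `a`. A point found during excursion `a` is found no earlier than
`a` plus its distance to the root, and `a` is at least the total duration of the earlier excursions.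
Exchanging the order of summation, the expected time is at least
`meanDist h + ∑_a duration a * laterMass a`. Let `x` be the farthest distance of a discovery of
excursion `a`. It lasts at least `2 x`, and everything beyond `x` on its arc is found later; with
the forward bound at `x` this gives
`2 * h (found a) * laterMassOff a ≤ ρ * duration a * laterMass a`
(`Search.two_mul_found_mul_le`), where `laterMassOff a` is the mass found later on other arcs.
The left-hand sides sum to the mass of the pairs of points on different arcs, that is to
`∑_{i ≠ k} (ρ λ_i) (ρ λ_k)`, which is the bound `V` (`Search.le_expectedTime`).

*Uniqueness.* Under the strict forward bound, equality in the last estimate makes every excursion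
after which something is left to find a complete tour of an arc
(`Search.complete_of_laterMass_ne_zero`). Hence each arc has one excursion that finds all of its
mass, and that goes straight to the leaf. In the order of these excursions, the search is at the
root and at the leaves at the same times as a depth-first search, which determines it in between
(`Search.agree_of_leaves`).
-/

noncomputable section

namespace StarNetwork

variable {Q : StarNetwork}

/-! ### Points and distances -/

theorem dist_eq (p q : Q.Point) : dist p q = ∑ i, |p.1 i - q.1 i| := by
  rw [Subtype.dist_eq, PiLp.dist_eq_of_L1]
  rfl

theorem dist_root (p : Q.Point) : dist Q.root p = ∑ i, p.1 i := by
  rw [dist_eq]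
  refine Finset.sum_congr rfl fun i _ => ?_
  have : Q.root.1 i = 0 := rfl
  rw [this, zero_sub, abs_neg, abs_of_nonneg (p.2.1 i).1]

theorem dist_root_of_mem_arc {p : Q.Point} {j : Fin Q.n} (hp : p ∈ Q.arc j) :
    dist Q.root p = p.1 j := by
  rw [dist_root]
  exact Finset.sum_eq_single j (fun i _ hi => hp i hi) (by simp)

theorem dist_root_le_len {p : Q.Point} {j : Fin Q.n} (hp : p ∈ Q.arc j) :
    dist Q.root p ≤ Q.len j := by
  rw [dist_root_of_mem_arc hp]
  exact (p.2.1 j).2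

theorem root_mem_arc (j : Fin Q.n) : Q.root ∈ Q.arc j := fun _ _ => rfl

theorem mem_arc_of_coord_ne_zero {p : Q.Point} {j : Fin Q.n} (hp : p.1 j ≠ 0) : p ∈ Q.arc j :=
  fun i hi => (p.2.2 i j hi).resolve_right hp

theorem ext_of_mem_arc {p q : Q.Point} {j : Fin Q.n} (hp : p ∈ Q.arc j) (hq : q ∈ Q.arc j)
    (h : p.1 j = q.1 j) : p = q := by
  apply Subtype.ext
  ext i
  by_cases hi : i = j
  · rw [hi, h]
  · rw [hp i hi, hq i hi]

theorem ext_of_dist_root {p q : Q.Point} {j : Fin Q.n} (hp : p ∈ Q.arc j) (hq : q ∈ Q.arc j)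
    (h : dist Q.root p = dist Q.root q) : p = q :=
  ext_of_mem_arc hp hq (by rw [← dist_root_of_mem_arc hp, h, dist_root_of_mem_arc hq])

theorem exists_coord_ne_zero {p : Q.Point} (hp : p ≠ Q.root) : ∃ j, p.1 j ≠ 0 := by
  by_contra! h
  exact hp (Subtype.ext (by ext i; rw [h i]; rfl))

theorem exists_mem_arc (p : Q.Point) : ∃ j, p ∈ Q.arc j := by
  by_cases hp : p = Q.root
  · exact ⟨⟨0, by have := Q.two_le_n; omega⟩, hp ▸ root_mem_arc _⟩
  · obtain ⟨j, hj⟩ := exists_coord_ne_zero hp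
    exact ⟨j, mem_arc_of_coord_ne_zero hj⟩

theorem eq_root_of_mem_arc {p : Q.Point} {i j : Fin Q.n} (hij : i ≠ j) (hi : p ∈ Q.arc i)
    (hj : p ∈ Q.arc j) : p = Q.root := by
  apply ext_of_mem_arc hi (root_mem_arc i)
  rw [hj i hij]; rfl

theorem coord_pos {p : Q.Point} {j : Fin Q.n} (hp : p ∈ Q.arc j) (h : p ≠ Q.root) :
    0 < p.1 j := by
  rw [← dist_root_of_mem_arc hp]
  exact dist_pos.2 h.symm

theorem dist_of_mem_arc {p q : Q.Point} {j : Fin Q.n} (hp : p ∈ Q.arc j) (hq : q ∈ Q.arc j) :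
    dist p q = |p.1 j - q.1 j| := by
  rw [dist_eq]
  refine Finset.sum_eq_single j (fun i _ hi => ?_) (by simp)
  rw [hp i hi, hq i hi, sub_zero, abs_zero]

theorem dist_of_mem_arc_ne {p q : Q.Point} {i j : Fin Q.n} (hij : i ≠ j) (hp : p ∈ Q.arc i)
    (hq : q ∈ Q.arc j) : dist p q = dist Q.root p + dist Q.root q := by
  rw [dist_eq, dist_root, dist_root, ← Finset.sum_add_distrib]
  refine Finset.sum_congr rfl fun k _ => ?_
  by_cases hk : k = i
  · rw [hq k (by rw [hk]; exact hij), sub_zero, add_zero, abs_of_nonneg (p.2.1 k).1]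
  · rw [hp k hk, zero_sub, zero_add, abs_neg, abs_of_nonneg (q.2.1 k).1]

/-- The point of arc `j` at distance `s` from the root; `s` is first projected to the interval
`[0, len j]`. -/
def pt (Q : StarNetwork) (j : Fin Q.n) (s : ℝ) : Q.Point :=
  ⟨WithLp.toLp 1 (Pi.single j (max 0 (min s (Q.len j)))), by
    constructor
    · intro i
      by_cases hi : i = j
      · subst hi
        simp [(Q.len_pos i).le]
      · simp [hi, (Q.len_pos i).le]
    · intro i k hik
      by_cases hi : i = j
      · exact Or.inr (Pi.single_eq_of_ne (fun h : k = j => hik (hi.trans h.symm)) _)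
      · left; simp [hi]⟩

theorem pt_mem_arc (j : Fin Q.n) (s : ℝ) : Q.pt j s ∈ Q.arc j := fun i hi => by
  simp [pt, hi]

theorem pt_coord (j : Fin Q.n) (s : ℝ) : (Q.pt j s).1 j = max 0 (min s (Q.len j)) := by
  simp [pt]

theorem pt_coord_of_mem {j : Fin Q.n} {s : ℝ} (h0 : 0 ≤ s) (h1 : s ≤ Q.len j) :
    (Q.pt j s).1 j = s := by
  rw [pt_coord, min_eq_left h1, max_eq_right h0]

theorem dist_root_pt {j : Fin Q.n} {s : ℝ} (h0 : 0 ≤ s) (h1 : s ≤ Q.len j) :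
    dist Q.root (Q.pt j s) = s := by
  rw [dist_root_of_mem_arc (pt_mem_arc j s), pt_coord_of_mem h0 h1]

theorem pt_eq {p : Q.Point} {j : Fin Q.n} (hp : p ∈ Q.arc j) : Q.pt j (dist Q.root p) = p :=
  ext_of_dist_root (pt_mem_arc _ _) hp (dist_root_pt dist_nonneg (dist_root_le_len hp))

theorem pt_zero (j : Fin Q.n) : Q.pt j 0 = Q.root :=
  ext_of_dist_root (pt_mem_arc _ _) (root_mem_arc _)
    (by rw [dist_root_pt le_rfl (Q.len_pos j).le, dist_self])

theorem dist_pt_le (j : Fin Q.n) (s t : ℝ) : dist (Q.pt j s) (Q.pt j t) ≤ |s - t| := by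
  rw [dist_of_mem_arc (pt_mem_arc j s) (pt_mem_arc j t), pt_coord, pt_coord]
  refine (abs_max_sub_max_le_max _ _ _ _).trans ?_
  rw [sub_self, abs_zero]
  refine max_le (abs_nonneg _) ((abs_min_sub_min_le_max _ _ _ _).trans ?_)
  rw [sub_self, abs_zero]
  exact max_le le_rfl (abs_nonneg _)

theorem continuous_coord (j : Fin Q.n) : Continuous fun p : Q.Point => p.1 j :=
  (PiLp.continuous_apply 1 _ j).comp continuous_subtype_val

theorem isClosed_arc (j : Fin Q.n) : IsClosed (Q.arc j) := by
  have : Q.arc j = ⋂ i, ⋂ (_ : i ≠ j), {p : Q.Point | p.1 i = 0} := by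
    ext p; simp [arc]
  rw [this]
  exact isClosed_iInter fun i => isClosed_iInter fun _ =>
    isClosed_eq (continuous_coord i) continuous_const

theorem measurableSet_arc (j : Fin Q.n) : MeasurableSet (Q.arc j) :=
  (isClosed_arc j).measurableSet

theorem continuous_dist_root : Continuous fun p : Q.Point => dist Q.root p :=
  continuous_const.dist continuous_id

instance compactSpace_point : CompactSpace Q.Point := by
  refine isCompact_iff_compactSpace.1 ?_
  refine Metric.isCompact_of_isClosed_isBounded ?_ ?_
  · have hc : ∀ j : Fin Q.n, Continuous fun p : PiLp 1 (fun _ : Fin Q.n => ℝ) => p j :=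
      fun j => PiLp.continuous_apply 1 _ j
    refine IsClosed.inter ?_ ?_
    · change IsClosed {p : PiLp 1 (fun _ : Fin Q.n => ℝ) | ∀ j, 0 ≤ p j ∧ p j ≤ Q.len j}
      simp only [Set.ofPred_forall, Set.ofPred_and]
      exact isClosed_iInter fun j => (isClosed_le continuous_const (hc j)).inter
        (isClosed_le (hc j) continuous_const)
    · change IsClosed {p : PiLp 1 (fun _ : Fin Q.n => ℝ) | ∀ i j, i ≠ j → p i = 0 ∨ p j = 0}
      simp only [Set.ofPred_forall, Set.ofPred_or]
      exact isClosed_iInter fun i => isClosed_iInter fun j => isClosed_iInter fun _ =>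
        (isClosed_eq (hc i) continuous_const).union (isClosed_eq (hc j) continuous_const)
  · refine (Metric.isBounded_iff_subset_closedBall 0).2 ⟨∑ j, Q.len j, fun p hp => ?_⟩
    rw [Metric.mem_closedBall, PiLp.dist_eq_of_L1]
    refine Finset.sum_le_sum fun j _ => ?_
    rw [Real.dist_eq, show (0 : PiLp 1 (fun _ : Fin Q.n => ℝ)) j = 0 from rfl, sub_zero,
      abs_of_nonneg (hp.1 j).1]
    exact (hp.1 j).2

theorem len_lt_totalLength (j : Fin Q.n) : Q.len j < Q.totalLength := by
  have hn := Q.two_le_n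
  obtain ⟨k, hk⟩ : ∃ k : Fin Q.n, k ≠ j := by
    have : Nontrivial (Fin Q.n) := Fin.nontrivial_iff_two_le.2 hn
    exact exists_ne j
  have := Finset.add_le_sum (f := Q.len) (s := Finset.univ)
    (fun i _ => (Q.len_pos i).le) (Finset.mem_univ j) (Finset.mem_univ k) hk.symm
  have h2 := Q.len_pos k
  unfold totalLength
  linarith

/-! ### Search times and excursions -/

namespace Search

variable (S : Q.Search)

theorem continuous_path : Continuous S.path := S.lipschitz.continuous

theorem dist_path_le (s t : ℝ≥0) : dist (S.path s) (S.path t) ≤ |(s : ℝ) - t| := by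
  have := S.lipschitz.dist_le_mul s t
  rwa [NNReal.coe_one, one_mul, NNReal.dist_eq] at this

theorem dist_root_path_le (t : ℝ≥0) : dist Q.root (S.path t) ≤ t := by
  have := S.dist_path_le 0 t
  rwa [S.start, NNReal.coe_zero, zero_sub, abs_neg, abs_of_nonneg t.coe_nonneg] at this

variable {S}

theorem time_le {p : Q.Point} {t : ℝ≥0} (h : S.path t = p) : S.time p ≤ t :=
  iInf₂_le t h

theorem le_time {p : Q.Point} {c : ℝ≥0∞} (h : ∀ t : ℝ≥0, S.path t = p → c ≤ t) :
    c ≤ S.time p :=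
  le_iInf₂ h

/-- The infimum in the definition of the search time is attained. -/
theorem exists_time_eq {p : Q.Point} (h : S.time p ≠ ∞) :
    ∃ t : ℝ≥0, S.path t = p ∧ S.time p = t := by
  have hne : {t : ℝ≥0 | S.path t = p}.Nonempty := by
    by_contra hcon
    apply h
    rw [Set.not_nonempty_iff_eq_empty] at hcon
    refine top_le_iff.1 (le_time fun t ht => ?_)
    have : t ∈ {t : ℝ≥0 | S.path t = p} := ht
    rw [hcon] at this
    exact this.elim
  have hcl : IsClosed {t : ℝ≥0 | S.path t = p} := isClosed_eq S.continuous_path continuous_const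
  have hmem : sInf {t : ℝ≥0 | S.path t = p} ∈ {t : ℝ≥0 | S.path t = p} :=
    hcl.csInf_mem hne (OrderBot.bddBelow _)
  refine ⟨_, hmem, le_antisymm (time_le hmem) (le_time fun t ht => ?_)⟩
  exact ENNReal.coe_le_coe.2 (csInf_le (OrderBot.bddBelow _) ht)

theorem time_le_iff {p : Q.Point} {t : ℝ≥0} :
    S.time p ≤ t ↔ p ∈ S.path '' Set.Iic t := by
  constructor
  · intro h
    obtain ⟨s, hs, hst⟩ := exists_time_eq (ne_top_of_le_ne_top ENNReal.coe_ne_top h)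
    exact ⟨s, ENNReal.coe_le_coe.1 (hst ▸ h), hs⟩
  · rintro ⟨s, hs, rfl⟩
    exact (time_le rfl).trans (ENNReal.coe_le_coe.2 hs)

variable (S) in
theorem measurable_time : Measurable S.time := by
  refine measurable_of_Iic fun c => ?_
  by_cases hc : c = ∞
  · subst hc; simp
  · lift c to ℝ≥0 using hc
    have : S.time ⁻¹' Set.Iic (c : ℝ≥0∞) = S.path '' Set.Iic c := by
      ext p; exact time_le_iff
    rw [this, ← Set.Icc_bot]
    exact ((isCompact_Icc.image S.continuous_path).isClosed).measurableSet

variable (S) in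
theorem time_root : S.time Q.root = 0 :=
  le_antisymm (by simpa using time_le S.start) bot_le

/-- A path of the star that avoids the root stays on one arc. -/
theorem path_mem_arc {s t : ℝ≥0} (hst : s ≤ t)
    (h : ∀ u ∈ Set.Icc s t, S.path u ≠ Q.root) {j : Fin Q.n} (hj : S.path s ∈ Q.arc j) :
    S.path t ∈ Q.arc j := by
  -- The coordinate along arc `j`, counted negatively on the other arcs, would vanish in between.
  by_contra hcon
  set f : ℝ≥0 → ℝ := fun u => 2 * (S.path u).1 j - dist Q.root (S.path u) with hf
  have hfc : Continuous f :=
    (continuous_const.mul ((continuous_coord j).comp S.continuous_path)).sub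
      (continuous_dist_root.comp S.continuous_path)
  have h1 : 0 ≤ f s := by
    have := coord_pos hj (h s ⟨le_rfl, hst⟩)
    simp only [hf, dist_root_of_mem_arc hj]
    linarith
  have h2 : f t ≤ 0 := by
    have : (S.path t).1 j = 0 := by
      by_contra h0
      exact hcon (mem_arc_of_coord_ne_zero h0)
    simp only [hf, this]
    linarith [dist_nonneg (x := Q.root) (y := S.path t)]
  obtain ⟨u, hu, hu0⟩ := intermediate_value_Icc' hst hfc.continuousOn ⟨h2, h1⟩
  apply h u hu
  by_cases hc : (S.path u).1 j = 0
  · simp only [hf, hc] at hu0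
    exact (dist_eq_zero.1 (by linarith)).symm
  · have hm := mem_arc_of_coord_ne_zero hc
    simp only [hf, dist_root_of_mem_arc hm] at hu0
    exact absurd (by linarith) hc

/-- Along an arc, points closer to the root are found earlier. -/
theorem time_mono {p q : Q.Point} {j : Fin Q.n} (hp : p ∈ Q.arc j) (hq : q ∈ Q.arc j)
    (hpq : dist Q.root p ≤ dist Q.root q) : S.time p ≤ S.time q := by
  refine le_time fun t ht => ?_
  by_cases hp0 : p = Q.root
  · rw [hp0, S.time_root]; exact bot_le
  have hc : ContinuousOn (fun u => (S.path u).1 j) (Set.Icc 0 t) :=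
    ((continuous_coord j).comp S.continuous_path).continuousOn
  have hmem : p.1 j ∈ Set.Icc ((S.path 0).1 j) ((S.path t).1 j) := by
    rw [S.start, ht, ← dist_root_of_mem_arc hp, ← dist_root_of_mem_arc hq]
    exact ⟨dist_nonneg, hpq⟩
  obtain ⟨u, hu, hup⟩ := intermediate_value_Icc (bot_le : (0 : ℝ≥0) ≤ t) hc hmem
  have hne : (S.path u).1 j ≠ 0 := by
    simp only at hup
    rw [hup]; exact (coord_pos hp hp0).ne'
  exact (time_le (ext_of_mem_arc (mem_arc_of_coord_ne_zero hne) hp hup)).trans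
    (ENNReal.coe_le_coe.2 hu.2)

variable (S)

/-- The excursion that starts at time `a`: the times after `a` at which `S` has not yet returned to
the root. -/
def excursion (a : ℝ≥0) : Set ℝ≥0 := {t | a < t ∧ ∀ s ∈ Set.Ioc a t, S.path s ≠ Q.root}

/-- The times at which `S` leaves the root. -/
def starts : Set ℝ≥0 := {a | S.path a = Q.root ∧ (S.excursion a).Nonempty}

/-- The duration of the excursion that starts at time `a`: the length of the time interval, which is
`∞` if the search does not return to the root. Lengths are measured in `ℝ`. -/
def duration (a : ℝ≥0) : ℝ≥0∞ := volume ((fun t : ℝ≥0 => (t : ℝ)) '' S.excursion a)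

/-- The points that `S` reaches for the first time during the excursion that starts at time
`a`. -/
def found (a : ℝ≥0) : Set Q.Point := {p | ∃ t ∈ S.excursion a, S.time p = t}

variable {S}

theorem lt_of_mem_excursion {a b t : ℝ≥0} (ht : t ∈ S.excursion a) (hb : S.path b = Q.root)
    (hab : a < b) : t < b := by
  by_contra hcon
  exact ht.2 b ⟨hab, not_lt.1 hcon⟩ hb

theorem excursion_disjoint {a b : ℝ≥0} (ha : S.path a = Q.root) (hb : S.path b = Q.root)
    (hab : a ≠ b) : Disjoint (S.excursion a) (S.excursion b) := by
  rw [Set.disjoint_left]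
  intro t hta htb
  rcases lt_or_gt_of_ne hab with h | h
  · exact absurd htb.1 (not_lt.2 (lt_of_mem_excursion hta hb h).le)
  · exact absurd hta.1 (not_lt.2 (lt_of_mem_excursion htb ha h).le)

theorem ordConnected_excursion (a : ℝ≥0) : (S.excursion a).OrdConnected := by
  refine ⟨fun s hs t ht u hu => ⟨hs.1.trans_le hu.1, fun v hv => ht.2 v ⟨hv.1, hv.2.trans hu.2⟩⟩⟩

theorem Ioc_subset_excursion {a t : ℝ≥0} (ht : t ∈ S.excursion a) :
    Set.Ioc a t ⊆ S.excursion a :=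
  fun _ hs => ⟨hs.1, fun v hv => ht.2 v ⟨hv.1, hv.2.trans hs.2⟩⟩

theorem measurableSet_excursion (a : ℝ≥0) : MeasurableSet (S.excursion a) :=
  (ordConnected_excursion a).measurableSet

theorem measurableEmbedding_nnreal_coe : MeasurableEmbedding (fun t : ℝ≥0 => (t : ℝ)) :=
  MeasurableEmbedding.subtype_coe (measurableSet_Ici : MeasurableSet (Set.Ici (0 : ℝ)))

theorem countable_starts : S.starts.Countable := by
  refine Set.PairwiseDisjoint.countable_of_nonempty_interior (s := S.excursion) ?_ ?_
  · intro a ha b hb hab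
    exact excursion_disjoint ha.1 hb.1 hab
  · rintro a ⟨_, t, ht⟩
    have h1 : Set.Ioo a t ⊆ interior (S.excursion a) :=
      interior_maximal (Set.Ioo_subset_Ioc_self.trans (Ioc_subset_excursion ht)) isOpen_Ioo
    exact (Set.nonempty_Ioo.2 ht.1).mono h1

instance : Countable S.starts := countable_starts.to_subtype

theorem found_disjoint {a b : ℝ≥0} (ha : S.path a = Q.root) (hb : S.path b = Q.root)
    (hab : a ≠ b) : Disjoint (S.found a) (S.found b) := by
  rw [Set.disjoint_left]
  rintro p ⟨s, hs, hs'⟩ ⟨t, ht, ht'⟩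
  have : s = t := ENNReal.coe_injective (hs'.symm.trans ht')
  subst this
  exact Set.disjoint_left.1 (excursion_disjoint ha hb hab) hs ht

theorem measurableSet_found (a : ℝ≥0) : MeasurableSet (S.found a) := by
  have : S.found a = S.time ⁻¹' ((fun t : ℝ≥0 => (t : ℝ≥0∞)) '' S.excursion a) := by
    ext p
    constructor
    · rintro ⟨t, ht, h⟩; exact ⟨t, ht, h.symm⟩
    · rintro ⟨t, ht, h⟩; exact ⟨t, ht, h.symm⟩
  rw [this]
  have hemb : MeasurableEmbedding (fun t : ℝ≥0 => (t : ℝ≥0∞)) :=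
    ENNReal.isOpenEmbedding_coe.measurableEmbedding
  exact S.measurable_time (hemb.measurableSet_image.2 (measurableSet_excursion a))

theorem path_eq_of_time_eq {p : Q.Point} {t : ℝ≥0} (h : S.time p = t) : S.path t = p := by
  obtain ⟨s, hs, hst⟩ := exists_time_eq (S := S) (p := p) (by rw [h]; exact ENNReal.coe_ne_top)
  have : s = t := ENNReal.coe_injective (hst.symm.trans h)
  rw [← this, hs]

theorem ne_root_of_mem_found {a : ℝ≥0} {p : Q.Point} (hp : p ∈ S.found a) : p ≠ Q.root := by
  obtain ⟨t, ht, h⟩ := hp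
  rw [← path_eq_of_time_eq h]
  exact ht.2 t ⟨ht.1, le_rfl⟩

/-- Every point that is found is found during some excursion. -/
theorem exists_mem_found {p : Q.Point} (hp : p ≠ Q.root) (h : S.time p ≠ ∞) :
    ∃ a ∈ S.starts, p ∈ S.found a := by
  obtain ⟨t, ht, htp⟩ := exists_time_eq h
  have hcomp : IsCompact ({s | S.path s = Q.root} ∩ Set.Icc 0 t) :=
    (isCompact_Icc).inter_left (isClosed_eq S.continuous_path continuous_const)
  -- the last visit to the root before the point is found
  obtain ⟨a, ⟨ha, hat⟩, hmax⟩ := hcomp.exists_isGreatest ⟨0, S.start, le_rfl, bot_le⟩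
  have hlt : a < t := lt_of_le_of_ne hat.2 fun he => hp (by rw [← ht, ← he]; exact ha)
  have hexc : t ∈ S.excursion a := ⟨hlt, fun s hs hroot =>
    absurd (hmax ⟨hroot, bot_le, hs.2⟩) (not_le.2 hs.1)⟩
  exact ⟨a, ⟨ha, t, hexc⟩, t, hexc, htp⟩

/-- Each excursion takes place on one arc. -/
theorem exists_excursion_arc {a : ℝ≥0} (ha : a ∈ S.starts) :
    ∃ j, ∀ t ∈ S.excursion a, S.path t ∈ Q.arc j := by
  obtain ⟨_, s, hs⟩ := ha
  obtain ⟨j, hj⟩ := exists_mem_arc (S.path s)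
  refine ⟨j, fun t ht => ?_⟩
  rcases le_total s t with h | h
  · exact path_mem_arc h (fun u hu => ht.2 u ⟨hs.1.trans_le hu.1, hu.2⟩) hj
  · obtain ⟨i, hi⟩ := exists_mem_arc (S.path t)
    have h2 := path_mem_arc h (fun u hu => hs.2 u ⟨ht.1.trans_le hu.1, hu.2⟩) hi
    by_cases hij : i = j
    · rwa [← hij]
    · exact absurd (eq_root_of_mem_arc hij h2 hj) (hs.2 s ⟨hs.1, le_rfl⟩)

variable (S) in
/-- The arc on which the excursion that starts at time `a` takes place. -/
def excursionArc (a : S.starts) : Fin Q.n := (exists_excursion_arc a.2).choose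

theorem path_mem_excursionArc (a : S.starts) {t : ℝ≥0} (ht : t ∈ S.excursion a) :
    S.path t ∈ Q.arc (S.excursionArc a) :=
  (exists_excursion_arc a.2).choose_spec t ht

theorem found_subset_arc (a : S.starts) : S.found a ⊆ Q.arc (S.excursionArc a) := by
  rintro p ⟨t, ht, h⟩
  rw [← path_eq_of_time_eq h]
  exact path_mem_excursionArc a ht

theorem coe_add_dist_le {a t : ℝ≥0} (ha : S.path a = Q.root) (hat : a ≤ t) :
    (a : ℝ) + dist Q.root (S.path t) ≤ t := by
  have := S.dist_path_le a t
  have h2 : (a : ℝ) ≤ t := hat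
  rw [ha, abs_sub_comm, abs_of_nonneg (sub_nonneg.2 h2)] at this
  linarith

theorem le_time_of_mem_found {a : ℝ≥0} (ha : S.path a = Q.root) {p : Q.Point}
    (hp : p ∈ S.found a) : (a : ℝ≥0∞) + ENNReal.ofReal (dist Q.root p) ≤ S.time p := by
  obtain ⟨t, ht, h⟩ := hp
  have := coe_add_dist_le ha ht.1.le
  rw [path_eq_of_time_eq h] at this
  rw [h, ← ENNReal.ofReal_coe_nnreal (p := a), ← ENNReal.ofReal_coe_nnreal (p := t),
    ← ENNReal.ofReal_add a.coe_nonneg dist_nonneg]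
  exact ENNReal.ofReal_le_ofReal this

/-- An excursion lasts at least as long as it takes to go to any of its points and back. -/
theorem two_mul_dist_le_duration {a t : ℝ≥0} (ha : S.path a = Q.root) (ht : t ∈ S.excursion a) :
    ENNReal.ofReal (2 * dist Q.root (S.path t)) ≤ S.duration a := by
  -- after time `t` the search needs at least the distance to the root to get back
  have hsub : Set.Ioo (a : ℝ) (t + dist Q.root (S.path t)) ⊆
      (fun t : ℝ≥0 => (t : ℝ)) '' S.excursion a := by
    intro s hs
    lift s to ℝ≥0 using a.2.trans hs.1.le
    refine ⟨s, ⟨hs.1, fun u hu hroot => ?_⟩, rfl⟩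
    rcases le_or_gt u t with hut | hut
    · exact ht.2 u ⟨hu.1, hut⟩ hroot
    · have h1 := S.dist_path_le u t
      have h3 : (t : ℝ) < u := hut
      have h4 : (u : ℝ) ≤ s := hu.2
      rw [hroot, abs_of_pos (sub_pos.2 h3)] at h1
      linarith [hs.2]
  refine le_trans ?_ (measure_mono hsub)
  rw [Real.volume_Ioo]
  have := coe_add_dist_le ha ht.1.le
  exact ENNReal.ofReal_le_ofReal (by linarith)

theorem two_mul_dist_le_duration_of_mem_found {a : ℝ≥0} (ha : S.path a = Q.root) {p : Q.Point}
    (hp : p ∈ S.found a) : ENNReal.ofReal (2 * dist Q.root p) ≤ S.duration a := by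
  obtain ⟨t, ht, h⟩ := hp
  have := two_mul_dist_le_duration ha ht
  rwa [path_eq_of_time_eq h] at this

/-- An excursion starts no earlier than the total duration of the earlier ones. -/
theorem tsum_duration_le (a : S.starts) :
    ∑' b : S.starts, (if b < a then S.duration b else 0) ≤ (a : ℝ≥0) := by
  set f : S.starts → Set ℝ := fun b =>
    if b < a then (fun t : ℝ≥0 => (t : ℝ)) '' S.excursion b else ∅ with hf
  have h1 : ∀ b, (if b < a then S.duration b else 0) = volume (f b) := by
    intro b
    by_cases h : b < a <;> simp [hf, h, duration]
  simp_rw [h1]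
  rw [← measure_iUnion]
  · have : (⋃ b, f b) ⊆ Set.Icc 0 (a : ℝ≥0) := by
      refine Set.iUnion_subset fun b => ?_
      by_cases h : b < a
      · simp only [hf, h, if_true]
        rintro _ ⟨t, ht, rfl⟩
        exact ⟨t.2, (lt_of_mem_excursion ht a.2.1 h).le⟩
      · simp [hf, h]
    refine (measure_mono this).trans ?_
    rw [Real.volume_Icc, sub_zero, ENNReal.ofReal_coe_nnreal]
  · intro b c hbc
    by_cases hb : b < a
    · by_cases hc : c < a
      · simp only [Function.onFun, hf, hb, hc, if_true]
        exact (Set.disjoint_image_iff NNReal.coe_injective).2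
          (excursion_disjoint b.2.1 c.2.1 (fun h => hbc (Subtype.ext h)))
      · simp [Function.onFun, hf, hc]
    · simp [Function.onFun, hf, hb]
  · intro b
    by_cases hb : b < a
    · simp only [hf, hb, if_true]
      exact measurableEmbedding_nnreal_coe.measurableSet_image.2 (measurableSet_excursion _)
    · simp [hf, hb]

/-- Points found during a later excursion to the same arc are farther from the root. -/
theorem dist_lt_of_mem_found {a b : S.starts} (hab : a < b)
    (harc : S.excursionArc a = S.excursionArc b) {p q : Q.Point} (hp : p ∈ S.found a)
    (hq : q ∈ S.found b) : dist Q.root p < dist Q.root q := by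
  by_contra hcon
  have hm := time_mono (S := S) (found_subset_arc b hq) (harc ▸ found_subset_arc a hp)
    (not_lt.1 hcon)
  obtain ⟨s, hs, hs'⟩ := hp
  obtain ⟨t, ht, ht'⟩ := hq
  rw [hs', ht', ENNReal.coe_le_coe] at hm
  exact absurd (hm.trans_lt (lt_of_mem_excursion hs b.2.1 hab)) (not_lt.2 ht.1.le)

end Search

/-! ### Construction of searches -/

namespace Search

/-- The search that first goes to distance `x` along arc `j`, returns to the root, and then
behaves as `S`. -/
def prepend (S : Q.Search) (j : Fin Q.n) (x : ℝ≥0) : Q.Search where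
  path t := if (t : ℝ) ≤ 2 * x then Q.pt j (min t (2 * x - t)) else S.path (t - 2 * x)
  start := by
    have hx : (0 : ℝ) ≤ 2 * x := by positivity
    simp only [NNReal.coe_zero, sub_zero, min_eq_left hx, if_pos hx, pt_zero]
  lipschitz := by
    refine LipschitzWith.of_dist_le_mul fun s t => ?_
    rw [NNReal.coe_one, one_mul, NNReal.dist_eq]
    wlog hst : (s : ℝ) ≤ t generalizing s t
    · have := this t s (not_le.1 hst).le
      rwa [dist_comm, abs_sub_comm] at this
    by_cases ht : (t : ℝ) ≤ 2 * x
    · rw [if_pos ht, if_pos (hst.trans ht)]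
      refine (dist_pt_le _ _ _).trans ((abs_min_sub_min_le_max _ _ _ _).trans (max_le le_rfl ?_))
      rw [sub_sub_sub_cancel_left, abs_sub_comm]
    · rw [if_neg ht]
      have ht' : ((t - 2 * x : ℝ≥0) : ℝ) = t - 2 * x := by
        rw [NNReal.coe_sub (by exact_mod_cast (not_le.1 ht).le)]; push_cast; rfl
      by_cases hs : (s : ℝ) ≤ 2 * x
      · rw [if_pos hs]
        have h1 : dist (Q.pt j (min s (2 * x - s))) Q.root ≤ 2 * x - s := by
          rw [← pt_zero j]
          refine (dist_pt_le _ _ _).trans ?_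
          rw [sub_zero, abs_of_nonneg (le_min s.coe_nonneg (by linarith))]
          exact min_le_right _ _
        have h2 := S.dist_root_path_le (t - 2 * x)
        rw [ht'] at h2
        rw [abs_sub_comm, abs_of_nonneg (by linarith)]
        linarith [dist_triangle (Q.pt j (min s (2 * x - s))) Q.root (S.path (t - 2 * x))]
      · rw [if_neg hs]
        have hs' : ((s - 2 * x : ℝ≥0) : ℝ) = s - 2 * x := by
          rw [NNReal.coe_sub (by exact_mod_cast (not_le.1 hs).le)]; push_cast; rfl
        have := S.dist_path_le (s - 2 * x) (t - 2 * x)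
        rwa [hs', ht', sub_sub_sub_cancel_right] at this

theorem prepend_path_of_le (S : Q.Search) (j : Fin Q.n) (x : ℝ≥0) {t : ℝ≥0}
    (ht : (t : ℝ) ≤ 2 * x) : (S.prepend j x).path t = Q.pt j (min t (2 * x - t)) := if_pos ht

theorem prepend_path_add (S : Q.Search) (j : Fin Q.n) (x t : ℝ≥0) :
    (S.prepend j x).path (2 * x + t) = S.path t := by
  by_cases ht : t = 0
  · subst ht
    rw [S.start, prepend_path_of_le _ _ _ (by push_cast; linarith)]
    push_cast
    rw [add_zero, sub_self, min_eq_right (by positivity), pt_zero]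
  · refine (if_neg ?_).trans (by rw [add_tsub_cancel_left])
    have : (0 : ℝ) < t := NNReal.coe_pos.2 (pos_iff_ne_zero.2 ht)
    push_cast; linarith

theorem prepend_time_le (S : Q.Search) (j : Fin Q.n) (x : ℝ≥0) (p : Q.Point) :
    (S.prepend j x).time p ≤ 2 * x + S.time p := by
  by_cases h : S.time p = ∞
  · rw [h]; simp
  · obtain ⟨t, ht, htp⟩ := exists_time_eq h
    rw [htp]
    have := time_le ((prepend_path_add S j x t).trans ht)
    push_cast at this
    exact this

theorem prepend_time_near (S : Q.Search) {j : Fin Q.n} {x : ℝ≥0} {p : Q.Point}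
    (hp : p ∈ Q.arc j) (hx : dist Q.root p ≤ x) :
    (S.prepend j x).time p ≤ ENNReal.ofReal (dist Q.root p) := by
  refine (time_le (t := (dist Q.root p).toNNReal) ?_).trans le_rfl
  have h0 : (0 : ℝ) ≤ dist Q.root p := dist_nonneg
  rw [prepend_path_of_le _ _ _ (by rw [Real.coe_toNNReal _ h0]; linarith), Real.coe_toNNReal _ h0,
    min_eq_left (by linarith), pt_eq hp]

/-- The search `S` tours the arcs in the order `σ`. -/
def Follows (S : Q.Search) (σ : Equiv.Perm (Fin Q.n)) : Prop :=
  ∀ (k : Fin Q.n) (t : ℝ≥0), tourStart σ k ≤ t → t ≤ tourStart σ k + 2 * Q.len (σ k) →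
    S.path t = Q.pt (σ k) (min (t - tourStart σ k) (tourStart σ k + 2 * Q.len (σ k) - t))

theorem isDepthFirst_iff {S : Q.Search} : S.IsDepthFirst ↔ ∃ σ, S.Follows σ := by
  refine exists_congr fun σ =>
    ⟨fun h k t h1 h2 => ?_, fun h k t => ⟨fun h1 h2 => ?_, fun h1 h2 => ?_⟩⟩
  · rcases le_total (t : ℝ) (tourStart σ k + Q.len (σ k)) with h3 | h3
    · obtain ⟨ha, hd⟩ := (h k t).1 h1 h3
      rw [min_eq_left (by linarith), ← hd, pt_eq ha]
    · obtain ⟨ha, hd⟩ := (h k t).2 h3 h2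
      rw [min_eq_right (by linarith), ← hd, pt_eq ha]
  · have := Q.len_pos (σ k)
    rw [h k t h1 (by linarith), min_eq_left (by linarith)]
    exact ⟨pt_mem_arc _ _, dist_root_pt (by linarith) (by linarith)⟩
  · have := Q.len_pos (σ k)
    rw [h k t (by linarith) h2, min_eq_right (by linarith)]
    exact ⟨pt_mem_arc _ _, dist_root_pt (by linarith) (by linarith)⟩

end Search

/-- The total duration of the first `m` tours, if the arcs are toured in the order
`σ 0, σ 1, …`. -/
def tourTime (σ : Equiv.Perm (Fin Q.n)) (m : ℕ) : ℝ :=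
  2 * ∑ i with i.val < m, Q.len (σ i)

theorem tourTime_coe (σ : Equiv.Perm (Fin Q.n)) (k : Fin Q.n) : tourTime σ k = tourStart σ k := by
  unfold tourTime tourStart
  congr 2
  ext i
  simp

theorem tourTime_zero (σ : Equiv.Perm (Fin Q.n)) : tourTime σ 0 = 0 := by
  simp [tourTime]

theorem tourTime_succ (σ : Equiv.Perm (Fin Q.n)) (k : Fin Q.n) :
    tourTime σ (k + 1) = tourStart σ k + 2 * Q.len (σ k) := by
  have : (Finset.univ.filter fun i : Fin Q.n => i.val < k + 1) = insert k (Finset.Iio k) := by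
    ext i
    simp only [Finset.mem_filter, Finset.mem_univ, true_and, Finset.mem_insert, Finset.mem_Iio,
      Fin.ext_iff, Fin.lt_def]
    omega
  rw [tourTime, this, Finset.sum_insert (by simp), tourStart]
  ring

theorem tourTime_n (σ : Equiv.Perm (Fin Q.n)) : tourTime σ Q.n = 2 * Q.totalLength := by
  unfold tourTime totalLength
  rw [Finset.filter_true_of_mem (fun i _ => i.2), Equiv.sum_comp σ Q.len]

theorem tourTime_mono (σ : Equiv.Perm (Fin Q.n)) : Monotone (tourTime σ) := by
  intro a b hab
  refine mul_le_mul_of_nonneg_left ?_ zero_le_two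
  refine Finset.sum_le_sum_of_subset_of_nonneg ?_ (fun i _ _ => (Q.len_pos _).le)
  exact Finset.monotone_filter_right _ fun i _ h => lt_of_lt_of_le h hab

theorem tourStart_nonneg (σ : Equiv.Perm (Fin Q.n)) (k : Fin Q.n) : 0 ≤ tourStart σ k := by
  rw [← tourTime_coe, ← tourTime_zero σ]
  exact tourTime_mono σ (Nat.zero_le _)

theorem tourStart_add_le (σ : Equiv.Perm (Fin Q.n)) {i k : Fin Q.n} (h : i < k) :
    tourStart σ i + 2 * Q.len (σ i) ≤ tourStart σ k := by
  rw [← tourTime_succ, ← tourTime_coe σ k]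
  exact tourTime_mono σ h

theorem tourStart_add_le_total (σ : Equiv.Perm (Fin Q.n)) (k : Fin Q.n) :
    tourStart σ k + 2 * Q.len (σ k) ≤ 2 * Q.totalLength := by
  rw [← tourTime_succ, ← tourTime_n σ]
  exact tourTime_mono σ k.2

/-- Each time until the end of the last tour belongs to some tour. -/
theorem exists_tour (σ : Equiv.Perm (Fin Q.n)) {t : ℝ} (h0 : 0 ≤ t) {m : ℕ} (hm : m ≤ Q.n)
    (ht : t < tourTime σ m) :
    ∃ k : Fin Q.n, k.val < m ∧ tourStart σ k ≤ t ∧ t < tourStart σ k + 2 * Q.len (σ k) := by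
  induction m with
  | zero => rw [tourTime_zero] at ht; linarith
  | succ m ih =>
    rcases lt_or_ge t (tourTime σ m) with h | h
    · obtain ⟨k, hk, h⟩ := ih (by omega) h
      exact ⟨k, by omega, h⟩
    · refine ⟨⟨m, hm⟩, Nat.lt_succ_self m, ?_, ?_⟩
      · rw [← tourTime_coe]; exact h
      · rw [← tourTime_succ]; exact ht

/-- Every order of the arcs is followed by some search; the tours are prepended one by one,
the last tour first. -/
theorem exists_follows (σ : Equiv.Perm (Fin Q.n)) : ∃ S : Q.Search, S.Follows σ := by
  -- the last `d` tours, on a clock that starts with the first of them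
  have key : ∀ d m : ℕ, m + d = Q.n → ∃ S : Q.Search, ∀ k : Fin Q.n, m ≤ k.val → ∀ t : ℝ≥0,
      tourStart σ k ≤ tourTime σ m + t →
      tourTime σ m + t ≤ tourStart σ k + 2 * Q.len (σ k) →
      S.path t = Q.pt (σ k) (min (tourTime σ m + t - tourStart σ k)
        (tourStart σ k + 2 * Q.len (σ k) - (tourTime σ m + t))) := by
    intro d
    induction d with
    | zero =>
      intro m hm
      exact ⟨⟨fun _ => Q.root, rfl, LipschitzWith.const' _⟩, fun k hk => absurd k.2 (by omega)⟩
    | succ d ih =>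
      intro m hm
      obtain ⟨S, hS⟩ := ih (m + 1) (by omega)
      set j : Fin Q.n := ⟨m, by omega⟩ with hj
      set x : ℝ≥0 := ⟨Q.len (σ j), (Q.len_pos _).le⟩ with hx
      have hxc : (x : ℝ) = Q.len (σ j) := rfl
      have hsucc : tourTime σ (m + 1) = tourTime σ m + 2 * x := by
        rw [hxc, show m + 1 = j.val + 1 from rfl, tourTime_succ, ← tourTime_coe]
      refine ⟨S.prepend (σ j) x, fun k hk t h1 h2 => ?_⟩
      by_cases hkm : k = j
      · have hst : tourStart σ j = tourTime σ m := (tourTime_coe σ j).symm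
        rw [hkm, hst] at h2 ⊢
        rw [Search.prepend_path_of_le _ _ _ (by rw [hxc]; linarith), hxc]
        congr 2 <;> ring
      · have hlt : j < k := by
          rw [Fin.lt_def]; rw [Fin.ext_iff] at hkm
          simp only [hj] at hkm ⊢; omega
        have h3 := tourStart_add_le σ hlt
        rw [← tourTime_succ, show j.val + 1 = m + 1 from rfl, hsucc] at h3
        have hle : 2 * x ≤ t := by
          rw [← NNReal.coe_le_coe]; push_cast; linarith
        obtain ⟨s, rfl⟩ := exists_add_of_le hle
        have he : tourTime σ m + (2 * x + s : ℝ≥0) = tourTime σ (m + 1) + s := by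
          rw [hsucc]; push_cast; ring
        rw [he] at h1 h2 ⊢
        rw [Search.prepend_path_add]
        exact hS k (by rw [Fin.lt_def] at hlt; exact hlt) s h1 h2
  obtain ⟨S, hS⟩ := key Q.n 0 (zero_add _)
  refine ⟨S, fun k t h1 h2 => ?_⟩
  have := hS k (Nat.zero_le _) t
  rw [tourTime_zero, zero_add] at this
  exact this h1 h2

/-- A point is found on the way out, during the tour of its arc. -/
theorem Search.Follows.time_eq {S : Q.Search} {σ : Equiv.Perm (Fin Q.n)} (hS : S.Follows σ)
    {k : Fin Q.n} {p : Q.Point} (hp : p ∈ Q.arc (σ k)) (hp0 : p ≠ Q.root) :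
    S.time p = ENNReal.ofReal (dist Q.root p) + ENNReal.ofReal (tourStart σ k) := by
  have hts := tourStart_nonneg σ k
  have hl := dist_root_le_len hp
  have hd : 0 < dist Q.root p := dist_pos.2 hp0.symm
  rw [← ENNReal.ofReal_add hd.le hts]
  apply le_antisymm
  · refine (Search.time_le (t := (dist Q.root p + tourStart σ k).toNNReal) ?_).trans le_rfl
    have hc : (((dist Q.root p + tourStart σ k).toNNReal : ℝ≥0) : ℝ) =
      dist Q.root p + tourStart σ k := Real.coe_toNNReal _ (by linarith)
    rw [hS k _ (by rw [hc]; linarith) (by rw [hc]; linarith), hc, min_eq_left (by linarith),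
      add_sub_cancel_right, pt_eq hp]
  · refine Search.le_time fun t ht => ?_
    rw [← ENNReal.ofReal_coe_nnreal (p := t)]
    refine ENNReal.ofReal_le_ofReal ?_
    by_contra hcon
    rw [not_le] at hcon
    rcases le_or_gt (tourStart σ k) t with h | h
    · have h2 := hS k t h (by linarith)
      rw [min_eq_left (by linarith), ht] at h2
      have h3 : dist Q.root p = t - tourStart σ k := by
        rw [h2, dist_root_pt (by linarith) (by linarith)]
      linarith
    · rw [← tourTime_coe] at h
      obtain ⟨i, hik, h1, h2⟩ := exists_tour σ t.coe_nonneg k.2.le h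
      have h3 := hS i t h1 h2.le
      have h4 : p ∈ Q.arc (σ i) := by rw [← ht, h3]; exact pt_mem_arc _ _
      have hne : σ i ≠ σ k := fun he => by
        rw [σ.injective he] at hik; exact lt_irrefl _ hik
      exact hp0 (eq_root_of_mem_arc hne h4 hp)

/-! ### Expected search times of the depth-first searches -/

/-- The `j`-th branch at the root: the `j`-th arc without the root. -/
def branch (Q : StarNetwork) (j : Fin Q.n) : Set Q.Point := Q.arc j \ {Q.root}

theorem measurableSet_branch (j : Fin Q.n) : MeasurableSet (Q.branch j) :=
  (measurableSet_arc j).diff (measurableSet_singleton _)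

theorem branch_disjoint {i j : Fin Q.n} (hij : i ≠ j) : Disjoint (Q.branch i) (Q.branch j) := by
  rw [Set.disjoint_left]
  exact fun p hi hj => hi.2 (eq_root_of_mem_arc hij hi.1 hj.1)

theorem iUnion_branch : ⋃ j, Q.branch j = {Q.root}ᶜ := by
  ext p
  simp only [Set.mem_iUnion, branch, Set.mem_sdiff, Set.mem_singleton_iff, Set.mem_compl_iff]
  refine ⟨fun ⟨_, _, h⟩ => h, fun h => ?_⟩
  obtain ⟨j, hj⟩ := exists_mem_arc p
  exact ⟨j, hj, h⟩

theorem lintegral_compl_root (h : Measure Q.Point) (f : Q.Point → ℝ≥0∞) :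
    ∫⁻ p in {Q.root}ᶜ, f p ∂h = ∑ j, ∫⁻ p in Q.branch j, f p ∂h := by
  rw [← iUnion_branch, lintegral_iUnion measurableSet_branch (fun i j hij => branch_disjoint hij),
    tsum_fintype]

theorem lintegral_eq_compl_root (h : Measure Q.Point) {f : Q.Point → ℝ≥0∞} (hf : f Q.root = 0) :
    ∫⁻ p, f p ∂h = ∫⁻ p in {Q.root}ᶜ, f p ∂h := by
  rw [← lintegral_add_compl f (measurableSet_singleton Q.root), Measure.restrict_singleton]
  simp [hf]

/-- The mean distance of the target from the root. -/
def meanDist (h : Measure Q.Point) : ℝ≥0∞ := ∫⁻ p, ENNReal.ofReal (dist Q.root p) ∂h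

theorem meanDist_eq (h : Measure Q.Point) :
    meanDist h = ∫⁻ p in {Q.root}ᶜ, ENNReal.ofReal (dist Q.root p) ∂h :=
  lintegral_eq_compl_root h (by simp)

theorem meanDist_ne_top (h : Measure Q.Point) [IsFiniteMeasure h] : meanDist h ≠ ∞ := by
  refine ne_top_of_le_ne_top (b := ∫⁻ _ : Q.Point, ENNReal.ofReal Q.totalLength ∂h) ?_
    (lintegral_mono fun p => ENNReal.ofReal_le_ofReal ?_)
  · rw [lintegral_const]
    exact ENNReal.mul_ne_top ENNReal.ofReal_ne_top (measure_ne_top _ _)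
  · obtain ⟨j, hj⟩ := exists_mem_arc p
    exact (dist_root_le_len hj).trans (len_lt_totalLength j).le

theorem expectedTime_eq (S : Q.Search) (h : Measure Q.Point) :
    S.expectedTime h = ∫⁻ p in {Q.root}ᶜ, S.time p ∂h :=
  lintegral_eq_compl_root h S.time_root

/-- The sum of the products of the lengths over all ordered pairs of different arcs. -/
def pairSum (Q : StarNetwork) : ℝ := ∑ i, ∑ k, if i ≠ k then Q.len i * Q.len k else 0

/-- Weighted by the lengths of the arcs, the starting times of the tours have a sum that does not
depend on the order: two different arcs contribute the same whichever comes first. -/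
theorem sum_tourStart_mul (σ : Equiv.Perm (Fin Q.n)) :
    ∑ k, tourStart σ k * Q.len (σ k) = Q.pairSum := by
  have h1 : Q.pairSum = ∑ i, ∑ k, if i ≠ k then Q.len (σ i) * Q.len (σ k) else 0 := by
    unfold pairSum
    rw [← Equiv.sum_comp σ]
    refine Finset.sum_congr rfl fun i _ => ?_
    rw [← Equiv.sum_comp σ]
    simp [σ.injective.eq_iff]
  have h2 : ∀ i k, (if i ≠ k then Q.len (σ i) * Q.len (σ k) else 0) =
      (if i < k then Q.len (σ i) * Q.len (σ k) else 0) +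
      (if k < i then Q.len (σ k) * Q.len (σ i) else 0) := by
    intro i k
    rcases lt_trichotomy i k with h | h | h
    · simp [h, h.ne, h.not_gt]
    · simp [h]
    · simp [h, h.ne', h.not_gt, mul_comm]
  have h3 : ∀ k, tourStart σ k * Q.len (σ k) =
      2 * ∑ i, if i < k then Q.len (σ i) * Q.len (σ k) else 0 := by
    intro k
    rw [← Finset.sum_filter, tourStart, mul_assoc, Finset.sum_mul]
    congr 2
    ext i; simp
  rw [h1]
  simp_rw [h2, h3, Finset.sum_add_distrib]
  rw [Finset.sum_comm, ← Finset.mul_sum]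
  ring

variable {h : Measure Q.Point} {ρ : ℝ}

/-- All depth-first searches have the same expected time against a balanced distribution. -/
theorem Search.Follows.expectedTime_eq [IsFiniteMeasure h]
    (hρ : ∀ j, h.real (Q.branch j) = ρ * Q.len j)
    {S : Q.Search} {σ : Equiv.Perm (Fin Q.n)} (hS : S.Follows σ) :
    S.expectedTime h = meanDist h + ENNReal.ofReal (ρ * Q.pairSum) := by
  have hρ0 : ∀ j, 0 ≤ ρ * Q.len j := fun j => (hρ j) ▸ measureReal_nonneg
  rw [StarNetwork.expectedTime_eq, lintegral_compl_root, meanDist_eq, lintegral_compl_root,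
    ← Equiv.sum_comp σ, ← Equiv.sum_comp σ (fun j => ∫⁻ p in Q.branch j,
      ENNReal.ofReal (dist Q.root p) ∂h), ← sum_tourStart_mul σ, Finset.mul_sum,
    ENNReal.ofReal_sum_of_nonneg, ← Finset.sum_add_distrib]
  · refine Finset.sum_congr rfl fun k _ => ?_
    have : ∫⁻ p in Q.branch (σ k), S.time p ∂h = ∫⁻ p in Q.branch (σ k),
        (ENNReal.ofReal (dist Q.root p) + ENNReal.ofReal (tourStart σ k)) ∂h :=
      setLIntegral_congr_fun (measurableSet_branch _) fun p hp => hS.time_eq hp.1 hp.2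
    rw [this, lintegral_add_right _ measurable_const, setLIntegral_const,
      show ρ * (tourStart σ k * Q.len (σ k)) = tourStart σ k * (ρ * Q.len (σ k)) by ring,
      ENNReal.ofReal_mul (tourStart_nonneg σ k), ← hρ, ofReal_measureReal]
  · intro k _
    rw [show ρ * (tourStart σ k * Q.len (σ k)) = tourStart σ k * (ρ * Q.len (σ k)) by ring]
    exact mul_nonneg (tourStart_nonneg σ k) (hρ0 _)

/-- The part of the `j`-th branch within distance `x` of the root. -/
def near (Q : StarNetwork) (j : Fin Q.n) (x : ℝ) : Set Q.Point :=
  {p | p ∈ Q.branch j ∧ dist Q.root p ≤ x}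

theorem measurableSet_near (j : Fin Q.n) (x : ℝ) : MeasurableSet (Q.near j x) :=
  (measurableSet_branch j).inter (isClosed_le continuous_dist_root continuous_const).measurableSet

theorem near_subset_branch (j : Fin Q.n) (x : ℝ) : Q.near j x ⊆ Q.branch j := fun _ hp => hp.1

theorem near_len (j : Fin Q.n) : Q.near j (Q.len j) = Q.branch j :=
  Set.Subset.antisymm (near_subset_branch _ _) fun _ hp => ⟨hp, dist_root_le_len hp.1⟩

/-- The expected time of a search that makes an excursion to distance `x` on arc `j` before it
tours all arcs, arc `j` last. -/
theorem exists_last_prepend [IsFiniteMeasure h] (hρ : ∀ j, h.real (Q.branch j) = ρ * Q.len j)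
    (j : Fin Q.n) (x : ℝ≥0) : ∃ S : Q.Search,
      (S.prepend j x).expectedTime h ≤ meanDist h +
        ENNReal.ofReal (ρ * Q.pairSum + 2 * x * (ρ * Q.totalLength - h.real (Q.near j x))
          - 2 * (Q.totalLength - Q.len j) * h.real (Q.near j x)) := by
  have hρ0 : ∀ j, 0 ≤ ρ * Q.len j := fun j => (hρ j) ▸ measureReal_nonneg
  have hn := Q.two_le_n
  set l : Fin Q.n := ⟨Q.n - 1, by omega⟩ with hl
  set σ : Equiv.Perm (Fin Q.n) := Equiv.swap l j with hσ
  have hσl : σ l = j := Equiv.swap_apply_left l j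
  have htl : tourStart σ l = 2 * (Q.totalLength - Q.len j) := by
    have := tourTime_succ σ l
    rw [show l.val + 1 = Q.n by simp only [hl]; omega, tourTime_n, hσl] at this
    linarith
  obtain ⟨S, hS⟩ := exists_follows σ
  refine ⟨S, ?_⟩
  have hfar : ∀ k, ∀ p ∈ Q.branch (σ k), (S.prepend j x).time p ≤
      ENNReal.ofReal (dist Q.root p) + ENNReal.ofReal (2 * x + tourStart σ k) := by
    intro k p hp
    refine (Search.prepend_time_le S j x p).trans ?_
    rw [hS.time_eq hp.1 hp.2, ENNReal.ofReal_add (by positivity) (tourStart_nonneg σ k),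
      ENNReal.ofReal_mul zero_le_two, ENNReal.ofReal_coe_nnreal, ENNReal.ofReal_ofNat]
    exact (add_left_comm _ _ _).le
  -- the mass of each branch that is found only after the first excursion
  set w : Fin Q.n → ℝ := fun k => ρ * Q.len (σ k) - if k = l then h.real (Q.near j x) else 0
  have hw0 : ∀ k, 0 ≤ w k := by
    intro k
    by_cases hk : k = l
    · simp only [w, hk, if_true, hσl, ← hρ, sub_nonneg]
      exact measureReal_mono (near_subset_branch _ _)
    · simpa only [w, hk, if_false, sub_zero] using hρ0 _
  have hbr : ∀ k, ∫⁻ p in Q.branch (σ k), (S.prepend j x).time p ∂h ≤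
      ∫⁻ p in Q.branch (σ k), ENNReal.ofReal (dist Q.root p) ∂h +
        ENNReal.ofReal ((2 * x + tourStart σ k) * w k) := by
    intro k
    have h0 : (0 : ℝ) ≤ 2 * x + tourStart σ k :=
      add_nonneg (by positivity) (tourStart_nonneg σ k)
    have hw0k := hw0 k
    by_cases hk : k = l
    · rw [hk] at hw0k h0 ⊢
      have hdiff : ENNReal.ofReal (w l) = h (Q.branch (σ l) \ Q.near j x) := by
        rw [← ofReal_measureReal, measureReal_sdiff (by rw [hσl]; exact near_subset_branch _ _)
          (measurableSet_near _ _), hρ]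
        simp only [w, if_true]
      have hms := (measurableSet_branch (σ l)).diff (measurableSet_near j x)
      rw [ENNReal.ofReal_mul h0, hdiff, ← setLIntegral_const, ← lintegral_indicator hms]
      refine le_trans ?_ (add_le_add le_rfl (setLIntegral_le_lintegral (Q.branch (σ l)) _))
      rw [← lintegral_add_right _ (measurable_const.indicator hms)]
      refine setLIntegral_mono' (measurableSet_branch _) fun p hp => ?_
      by_cases hpn : p ∈ Q.near j x
      · exact (Search.prepend_time_near S hpn.1.1 hpn.2).trans le_self_add
      · rw [Set.indicator_of_mem (show p ∈ Q.branch (σ l) \ Q.near j x from ⟨hp, hpn⟩)]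
        exact hfar l p hp
    · have : w k = h.real (Q.branch (σ k)) := by
        simp only [w, hk, if_false, sub_zero, hρ]
      rw [ENNReal.ofReal_mul h0, this, ofReal_measureReal, ← setLIntegral_const,
        ← lintegral_add_right _ measurable_const]
      exact setLIntegral_mono' (measurableSet_branch _) (hfar k)
  rw [expectedTime_eq, lintegral_compl_root, meanDist_eq, lintegral_compl_root,
    ← Equiv.sum_comp σ, ← Equiv.sum_comp σ (fun j => ∫⁻ p in Q.branch j,
      ENNReal.ofReal (dist Q.root p) ∂h)]
  refine (Finset.sum_le_sum fun k _ => hbr k).trans ?_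
  rw [Finset.sum_add_distrib, ← ENNReal.ofReal_sum_of_nonneg]
  · refine add_le_add le_rfl (ENNReal.ofReal_le_ofReal (le_of_eq ?_))
    have h1 : ∀ k, (2 * x + tourStart σ k) * w k = ρ * (tourStart σ k * Q.len (σ k)) +
        2 * x * ρ * Q.len (σ k) -
        if k = l then (2 * x + tourStart σ k) * h.real (Q.near j x) else 0 := by
      intro k
      by_cases hk : k = l
      · simp only [w, hk, if_true]; ring
      · simp only [w, hk, if_false]; ring
    simp_rw [h1]
    rw [Finset.sum_sub_distrib, Finset.sum_add_distrib, ← Finset.mul_sum, ← Finset.mul_sum,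
      sum_tourStart_mul, Equiv.sum_comp σ Q.len, Finset.sum_ite_eq' , if_pos (Finset.mem_univ _),
      htl]
    simp only [totalLength]
    ring
  · intro k _
    exact mul_nonneg (add_nonneg (by positivity) (tourStart_nonneg σ k)) (hw0 k)

/-! ### Double sums -/

theorem eq_of_tsum_le {ι : Type*} {f g : ι → ℝ≥0∞} (hf : ∑' i, f i ≠ ∞) (hle : ∀ i, f i ≤ g i)
    (hsum : ∑' i, g i ≤ ∑' i, f i) (i : ι) : f i = g i := by
  by_contra hne
  exact absurd (ENNReal.tsum_lt_tsum hf hle (lt_of_le_of_ne (hle i) hne)) (not_lt.2 hsum)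

/-- Summation by parts. -/
theorem tsum_mul_tsum_lt {ι : Type*} [LinearOrder ι] (m d : ι → ℝ≥0∞) :
    ∑' a, m a * ∑' b, (if b < a then d b else 0) =
      ∑' b, d b * ∑' a, (if b < a then m a else 0) := by
  simp_rw [← ENNReal.tsum_mul_left]
  rw [ENNReal.tsum_comm]
  refine tsum_congr fun b => tsum_congr fun a => ?_
  split_ifs
  · exact mul_comm _ _
  · simp

/-- Pairs of indices with different labels, counted once in each order. -/
theorem two_mul_tsum_pairs {ι κ : Type*} [LinearOrder ι] [Fintype κ] [DecidableEq κ]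
    (m : ι → ℝ≥0∞) (l : ι → κ) :
    2 * ∑' a, m a * ∑' b, (if a < b ∧ l b ≠ l a then m b else 0) =
      ∑ i, ∑ k, if i ≠ k then
        (∑' a, if l a = i then m a else 0) * (∑' a, if l a = k then m a else 0) else 0 := by
  have h1 : ∀ a, m a * ∑' b, (if a < b ∧ l b ≠ l a then m b else 0) =
      ∑' b, if a < b ∧ l b ≠ l a then m a * m b else 0 := by
    intro a
    rw [← ENNReal.tsum_mul_left]
    simp_rw [mul_ite, mul_zero]
  simp_rw [h1]
  have h2 : ∑' a, ∑' b, (if a < b ∧ l b ≠ l a then m a * m b else 0) =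
      ∑' a, ∑' b, (if b < a ∧ l b ≠ l a then m a * m b else 0) := by
    rw [ENNReal.tsum_comm]
    refine tsum_congr fun b => tsum_congr fun a => ?_
    simp only [mul_comm (m a), ne_comm (a := l a)]
  rw [two_mul]
  nth_rw 2 [h2]
  rw [← ENNReal.tsum_add]
  simp_rw [← ENNReal.tsum_add]
  have h3 : ∀ a b, (if a < b ∧ l b ≠ l a then m a * m b else 0) +
      (if b < a ∧ l b ≠ l a then m a * m b else 0) =
      ∑ i, ∑ k, if i ≠ k then
        (if l a = i then m a else 0) * (if l b = k then m b else 0) else 0 := by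
    intro a b
    have h4 : (∑ i, ∑ k, if i ≠ k then
        (if l a = i then m a else 0) * (if l b = k then m b else 0) else 0) =
        if l b ≠ l a then m a * m b else 0 := by
      rw [Finset.sum_eq_single (l a) _ (by simp), Finset.sum_eq_single (l b) _ (by simp)]
      · simp [ne_comm]
      · intro k _ hk; simp [hk.symm]
      · intro i _ hi; simp [hi.symm]
    rw [h4]
    by_cases hl : l b = l a
    · simp [hl]
    · have hab : a ≠ b := fun h => hl (by rw [h])
      rcases lt_or_gt_of_ne hab with h | h
      · simp [h, h.not_gt, hl]
      · simp [h, h.not_gt, hl]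
  simp_rw [h3]
  have h5 : ∀ i k, (if i ≠ k then
      (∑' a, if l a = i then m a else 0) * (∑' a, if l a = k then m a else 0) else 0) =
      ∑' a, ∑' b, if i ≠ k then
        (if l a = i then m a else 0) * (if l b = k then m b else 0) else 0 := by
    intro i k
    by_cases hik : i = k
    · simp [hik]
    · simp only [ne_eq, hik, not_false_eq_true, if_true, ENNReal.tsum_mul_left,
        ENNReal.tsum_mul_right]
  simp_rw [h5]
  have h6 : ∀ F : ι → κ → ℝ≥0∞, ∑' a, ∑ i, F a i = ∑ i, ∑' a, F a i := by
    intro F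
    exact Summable.tsum_finsetSum fun _ _ => ENNReal.summable
  simp_rw [h6]

/-! ### Decomposition of the target set by excursions -/

namespace Search

variable {S : Q.Search} {h : Measure Q.Point}

theorem iUnion_found_ae_eq (ht : ∀ᵐ p ∂h, S.time p ≠ ∞) :
    (⋃ a : S.starts, S.found a : Set Q.Point) =ᵐ[h] ({Q.root}ᶜ : Set Q.Point) := by
  filter_upwards [ht] with p hp
  apply propext
  change p ∈ (⋃ a : S.starts, S.found a) ↔ p ∈ ({Q.root}ᶜ : Set Q.Point)
  rw [Set.mem_iUnion]
  constructor
  · rintro ⟨a, ha⟩; exact ne_root_of_mem_found ha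
  · intro h0
    obtain ⟨a, ha, h⟩ := exists_mem_found h0 hp
    exact ⟨⟨a, ha⟩, h⟩

theorem pairwise_disjoint_found :
    Pairwise (Function.onFun Disjoint fun a : S.starts => S.found a) :=
  fun a b hab => found_disjoint a.2.1 b.2.1 fun h => hab (Subtype.ext h)

theorem lintegral_found (ht : ∀ᵐ p ∂h, S.time p ≠ ∞) (f : Q.Point → ℝ≥0∞) :
    ∫⁻ p in {Q.root}ᶜ, f p ∂h = ∑' a : S.starts, ∫⁻ p in S.found a, f p ∂h := by
  rw [← setLIntegral_congr (iUnion_found_ae_eq ht),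
    lintegral_iUnion (fun a => measurableSet_found _) pairwise_disjoint_found]

theorem measure_eq_tsum_found (ht : ∀ᵐ p ∂h, S.time p ≠ ∞) {A : Set Q.Point}
    (hA : MeasurableSet A) (hA0 : Q.root ∉ A) : h A = ∑' a : S.starts, h (A ∩ S.found a) := by
  have h1 := lintegral_found ht (A.indicator 1)
  have h2 : ∀ B : Set Q.Point, ∫⁻ p in B, A.indicator 1 p ∂h = h (A ∩ B) := fun B => by
    rw [lintegral_indicator_one hA, Measure.restrict_apply hA]
  simp_rw [h2] at h1
  rw [← h1]
  congr 1
  have hsub : A ⊆ {Q.root}ᶜ := fun p hp h0 => hA0 (by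
    have h0' : p = Q.root := h0
    rwa [← h0'])
  rw [Set.inter_eq_left.2 hsub]

variable (S h) in
/-- The probability that the target is found during an excursion after the one that starts at time
`a`. -/
def laterMass (a : S.starts) : ℝ≥0∞ := ∑' b : S.starts, if a < b then h (S.found b) else 0

variable (S h) in
/-- The probability that the target is found during an excursion after the one that starts at time
`a`, and on a different arc. -/
def laterMassOff (a : S.starts) : ℝ≥0∞ :=
  ∑' b : S.starts, if a < b ∧ S.excursionArc b ≠ S.excursionArc a then h (S.found b) else 0

theorem found_subset_branch (a : S.starts) : S.found a ⊆ Q.branch (S.excursionArc a) :=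
  fun _ hp => ⟨found_subset_arc a hp, ne_root_of_mem_found hp⟩

theorem measure_branch_eq (ht : ∀ᵐ p ∂h, S.time p ≠ ∞) (j : Fin Q.n) :
    h (Q.branch j) = ∑' a : S.starts, if S.excursionArc a = j then h (S.found a) else 0 := by
  rw [measure_eq_tsum_found ht (measurableSet_branch j) (fun h => h.2 rfl)]
  refine tsum_congr fun a => ?_
  split_ifs with haj
  · rw [Set.inter_eq_right.2 (haj ▸ found_subset_branch a)]
  · rw [((branch_disjoint haj).symm.mono_right (found_subset_branch a)).inter_eq, measure_empty]

theorem laterMassOff_le (a : S.starts) : S.laterMassOff h a ≤ S.laterMass h a := by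
  refine ENNReal.tsum_le_tsum fun b => ?_
  by_cases hab : a < b
  · by_cases hj : S.excursionArc b = S.excursionArc a <;> simp [hab, hj]
  · simp [hab]

theorem laterMass_ne_top [IsFiniteMeasure h] (a : S.starts) : S.laterMass h a ≠ ∞ := by
  refine ne_top_of_le_ne_top (measure_ne_top h (⋃ b : S.starts, S.found b)) ?_
  rw [measure_iUnion pairwise_disjoint_found (fun a => measurableSet_found _)]
  refine ENNReal.tsum_le_tsum fun b => ?_
  split_ifs <;> simp

theorem laterMassOff_ne_top [IsFiniteMeasure h] (a : S.starts) : S.laterMassOff h a ≠ ∞ :=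
  ne_top_of_le_ne_top (laterMass_ne_top a) (laterMassOff_le a)

theorem le_laterMass {a b : S.starts} (hab : a < b) : h (S.found b) ≤ S.laterMass h a := by
  have := ENNReal.le_tsum (f := fun b : S.starts => if a < b then h (S.found b) else 0) b
  rw [if_pos hab] at this
  exact this

theorem duration_pos (a : S.starts) : 0 < S.duration a := by
  obtain ⟨t, ht⟩ := a.2.2
  refine lt_of_lt_of_le ?_ (two_mul_dist_le_duration a.2.1 ht)
  rw [ENNReal.ofReal_pos]
  have := dist_pos.2 (ht.2 t ⟨ht.1, le_rfl⟩).symm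
  linarith

theorem tsum_setLIntegral_add (ht : ∀ᵐ p ∂h, S.time p ≠ ∞) :
    ∑' a : S.starts, ∫⁻ p in S.found a, ((a : ℝ≥0) + ENNReal.ofReal (dist Q.root p)) ∂h =
      meanDist h + ∑' a : S.starts, h (S.found a) * (a : ℝ≥0) := by
  rw [meanDist_eq, lintegral_found ht, ← ENNReal.tsum_add]
  refine tsum_congr fun a => ?_
  rw [lintegral_add_left measurable_const, setLIntegral_const, add_comm, mul_comm]

/-- The two losses of a search: the time beyond the distance to the root that passes between the
start of an excursion and a discovery, and the time spent at the root. -/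
theorem tsum_found_mul_start (ht : ∀ᵐ p ∂h, S.time p ≠ ∞) :
    ∑' a : S.starts, ∫⁻ p in S.found a, ((a : ℝ≥0) + ENNReal.ofReal (dist Q.root p)) ∂h ≤
        S.expectedTime h ∧
      ∑' a : S.starts, S.duration a * S.laterMass h a ≤
        ∑' a : S.starts, h (S.found a) * (a : ℝ≥0) := by
  constructor
  · rw [StarNetwork.expectedTime_eq, lintegral_found ht]
    exact ENNReal.tsum_le_tsum fun a =>
      setLIntegral_mono' (measurableSet_found _) fun p hp => le_time_of_mem_found a.2.1 hp
  · unfold laterMass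
    rw [← tsum_mul_tsum_lt]
    exact ENNReal.tsum_le_tsum fun a => mul_le_mul_right (tsum_duration_le a) _

theorem ae_time_ne_top (hT : S.expectedTime h ≠ ∞) : ∀ᵐ p ∂h, S.time p ≠ ∞ :=
  (ae_lt_top S.measurable_time hT).mono fun _ hp => hp.ne

variable {ρ : ℝ} [IsFiniteMeasure h]

theorem measure_branch (hρ : ∀ j, h.real (Q.branch j) = ρ * Q.len j) (j : Fin Q.n) :
    h (Q.branch j) = ENNReal.ofReal (ρ * Q.len j) := by
  rw [← hρ, ofReal_measureReal]

/-- The farthest distance `x` reached by the discoveries of an excursion: everything on its arc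
beyond `x` is found later. -/
theorem exists_reach (hρ : ∀ j, h.real (Q.branch j) = ρ * Q.len j)
    (ht : ∀ᵐ p ∂h, S.time p ≠ ∞) (a : S.starts) (ha : h (S.found a) ≠ 0) :
    ∃ x : ℝ, 0 < x ∧ x ≤ Q.len (S.excursionArc a) ∧ ENNReal.ofReal (2 * x) ≤ S.duration a ∧
      (h (S.found a)).toReal ≤ h.real (Q.near (S.excursionArc a) x) ∧
      (S.laterMassOff h a).toReal + ρ * Q.len (S.excursionArc a)
        - h.real (Q.near (S.excursionArc a) x) ≤ (S.laterMass h a).toReal ∧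
      (S.laterMassOff h a).toReal ≤ ρ * (Q.totalLength - Q.len (S.excursionArc a)) := by
  set j := S.excursionArc a with hj
  obtain ⟨p, hp⟩ : (S.found a).Nonempty := by
    by_contra hne
    rw [Set.not_nonempty_iff_eq_empty] at hne
    exact ha (by rw [hne, measure_empty])
  -- the distances of the discoveries; `x` is their supremum
  set D : Set ℝ := (fun p => dist Q.root p) '' S.found a with hD
  have hDne : D.Nonempty := ⟨_, p, hp, rfl⟩
  have hDle : ∀ d ∈ D, d ≤ Q.len j := by
    rintro _ ⟨q, hq, rfl⟩
    exact dist_root_le_len (found_subset_arc a hq)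
  have hDbdd : BddAbove D := ⟨_, hDle⟩
  have hle : ∀ q ∈ S.found a, dist Q.root q ≤ sSup D := fun q hq => le_csSup hDbdd ⟨q, hq, rfl⟩
  have hsub : S.found a ⊆ Q.near j (sSup D) := fun q hq => ⟨found_subset_branch a hq, hle q hq⟩
  refine ⟨sSup D, ?_, csSup_le hDne hDle, ?_, ?_, ?_, ?_⟩
  · exact (dist_pos.2 (ne_root_of_mem_found hp).symm).trans_le (hle p hp)
  · by_cases htop : S.duration a = ∞
    · rw [htop]; exact le_top
    · rw [ENNReal.ofReal_le_iff_le_toReal htop]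
      have : sSup D ≤ (S.duration a).toReal / 2 := by
        refine csSup_le hDne ?_
        rintro _ ⟨q, hq, rfl⟩
        have := two_mul_dist_le_duration_of_mem_found a.2.1 hq
        rw [ENNReal.ofReal_le_iff_le_toReal htop] at this
        simp only
        linarith
      linarith
  · exact ENNReal.toReal_mono (measure_ne_top _ _) (measure_mono hsub)
  · have hfar : h (Q.branch j \ Q.near j (sSup D)) ≤
        ∑' b : S.starts, if a < b ∧ S.excursionArc b = j then h (S.found b) else 0 := by
      rw [measure_eq_tsum_found ht ((measurableSet_branch j).diff (measurableSet_near _ _))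
        (fun h => h.1.2 rfl)]
      refine ENNReal.tsum_le_tsum fun b => ?_
      split_ifs with hb
      · exact measure_mono Set.inter_subset_right
      · rw [nonpos_iff_eq_zero]
        convert! measure_empty (μ := h)
        rw [Set.eq_empty_iff_forall_notMem]
        rintro q ⟨⟨hq1, hq2⟩, hqb⟩
        by_cases hbj : S.excursionArc b = j
        · refine hq2 ⟨hq1, ?_⟩
          rcases lt_trichotomy a b with hab | hab | hab
          · exact absurd ⟨hab, hbj⟩ hb
          · exact hle q (hab ▸ hqb)
          · exact (dist_lt_of_mem_found hab hbj hqb hp).le.trans (hle p hp)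
        · exact Set.disjoint_left.1 (branch_disjoint hbj) (found_subset_branch b hqb) hq1
    have hadd : S.laterMassOff h a + h (Q.branch j \ Q.near j (sSup D)) ≤ S.laterMass h a := by
      refine (add_le_add le_rfl hfar).trans ?_
      unfold laterMassOff laterMass
      rw [← ENNReal.tsum_add]
      refine ENNReal.tsum_le_tsum fun b => ?_
      by_cases hab : a < b
      · by_cases hbj : S.excursionArc b = j <;> simp [hab, hbj, ← hj]
      · simp [hab]
    have hreal := ENNReal.toReal_mono (laterMass_ne_top a) hadd
    rw [ENNReal.toReal_add (laterMassOff_ne_top a) (measure_ne_top _ _)] at hreal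
    have hdiff : (h (Q.branch j \ Q.near j (sSup D))).toReal =
        ρ * Q.len j - h.real (Q.near j (sSup D)) := by
      rw [← hρ]
      exact measureReal_sdiff (near_subset_branch _ _) (measurableSet_near _ _)
    linarith
  · have hadd : S.laterMassOff h a + h (Q.branch j) ≤ ∑ k, h (Q.branch k) := by
      rw [measure_branch_eq ht j]
      simp_rw [measure_branch_eq ht]
      rw [← Summable.tsum_finsetSum (fun _ _ => ENNReal.summable)]
      unfold laterMassOff
      rw [← ENNReal.tsum_add]
      refine ENNReal.tsum_le_tsum fun b => ?_
      rw [Finset.sum_ite_eq, if_pos (Finset.mem_univ _)]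
      by_cases hbj : S.excursionArc b = j
      · simp [hbj, ← hj]
      · by_cases hab : a < b <;> simp [hab, hbj, ← hj]
    have hreal := ENNReal.toReal_mono (by simp [ENNReal.sum_eq_top]) hadd
    rw [ENNReal.toReal_add (laterMassOff_ne_top a) (measure_ne_top _ _),
      ENNReal.toReal_sum (fun _ _ => measure_ne_top _ _)] at hreal
    have h1 : ∀ k, (h (Q.branch k)).toReal = ρ * Q.len k := hρ
    simp_rw [h1, ← Finset.mul_sum] at hreal
    unfold totalLength
    linarith

/-- The estimate at the heart of the lower bound: an excursion takes time from everything found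
later, and the forward bound says that this outweighs what it gains over the later finds on other
arcs. -/
theorem two_mul_found_mul_le (hρ : ∀ j, h.real (Q.branch j) = ρ * Q.len j) (hρ0 : 0 ≤ ρ)
    (hfb : ∀ j x, 0 ≤ x → x ≤ Q.len j →
      h.real (Q.near j x) * (x + Q.totalLength - Q.len j) ≤ ρ * Q.totalLength * x)
    (ht : ∀ᵐ p ∂h, S.time p ≠ ∞) (a : S.starts) :
    2 * (h (S.found a) * S.laterMassOff h a) ≤
      ENNReal.ofReal ρ * (S.duration a * S.laterMass h a) := by
  by_cases ha : h (S.found a) = 0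
  · simp [ha]
  obtain ⟨x, hx0, hxl, hdur, hD, hR, hU⟩ := exists_reach hρ ht a ha
  have hfx := hfb _ x hx0.le hxl
  have hμ := len_lt_totalLength (S.excursionArc a)
  have hG : h.real (Q.near (S.excursionArc a) x) ≤ ρ * Q.len (S.excursionArc a) := by
    rw [← hρ]; exact measureReal_mono (near_subset_branch _ _)
  refine le_trans ?_ (mul_le_mul_right (mul_le_mul_left hdur _) _)
  rw [← ENNReal.ofReal_toReal (measure_ne_top h (S.found a)),
    ← ENNReal.ofReal_toReal (laterMass_ne_top (h := h) a),
    ← ENNReal.ofReal_toReal (laterMassOff_ne_top (h := h) a),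
    ← ENNReal.ofReal_mul ENNReal.toReal_nonneg, ← ENNReal.ofReal_mul (by positivity),
    ← ENNReal.ofReal_mul hρ0, ← ENNReal.ofReal_ofNat 2, ← ENNReal.ofReal_mul zero_le_two]
  apply ENNReal.ofReal_le_ofReal
  have hU0 : 0 ≤ (S.laterMassOff h a).toReal := ENNReal.toReal_nonneg
  generalize (S.laterMassOff h a).toReal = U at *
  generalize (S.laterMass h a).toReal = R at *
  generalize (h (S.found a)).toReal = D at *
  generalize h.real (Q.near (S.excursionArc a) x) = G at *
  generalize Q.len (S.excursionArc a) = l at *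
  generalize Q.totalLength = m at *
  have h1 : (m - l) * (D * U) ≤ (m - l) * (G * U) :=
    mul_le_mul_of_nonneg_left (mul_le_mul_of_nonneg_right hD hU0) (by linarith)
  have h2 : (m - l) * (ρ * (x * (U + ρ * l - G))) ≤ (m - l) * (ρ * (x * R)) :=
    mul_le_mul_of_nonneg_left (mul_le_mul_of_nonneg_left
      (mul_le_mul_of_nonneg_left hR hx0.le) hρ0) (by linarith)
  -- this is `x * U * (ρ * m - G) ≤ ρ * (m - l) * x * (U + ρ * l - G)`
  have h3 : 0 ≤ x * ((ρ * (m - l) - U) * (ρ * l - G)) :=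
    mul_nonneg hx0.le (mul_nonneg (by linarith) (by linarith))
  -- this is the forward bound, `(m - l) * G ≤ x * (ρ * m - G)`, multiplied by `U`
  have h4 : 0 ≤ U * (ρ * m * x - G * (x + m - l)) := mul_nonneg hU0 (by linarith)
  have h5 : (m - l) * (D * U) ≤ (m - l) * (ρ * (x * R)) := by linarith
  have h6 := le_of_mul_le_mul_left h5 (by linarith : 0 < m - l)
  linarith

theorem sum_pairs_branch (hρ : ∀ j, h.real (Q.branch j) = ρ * Q.len j) (hρ0 : 0 ≤ ρ) :
    (∑ i, ∑ k, if i ≠ k then h (Q.branch i) * h (Q.branch k) else 0) =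
      ENNReal.ofReal ρ * ENNReal.ofReal (ρ * Q.pairSum) := by
  have hl : ∀ j, 0 ≤ ρ * Q.len j := fun j => mul_nonneg hρ0 (Q.len_pos j).le
  have h1 : ∀ i k, (if i ≠ k then h (Q.branch i) * h (Q.branch k) else 0) =
      ENNReal.ofReal (if i ≠ k then ρ * Q.len i * (ρ * Q.len k) else 0) := by
    intro i k
    split_ifs
    · rw [measure_branch hρ, measure_branch hρ, ENNReal.ofReal_mul (hl i)]
    · simp
  have h2 : ∀ i k, 0 ≤ (if i ≠ k then ρ * Q.len i * (ρ * Q.len k) else 0) := by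
    intro i k
    split_ifs
    · exact mul_nonneg (hl i) (hl k)
    · exact le_rfl
  simp_rw [h1]
  simp_rw [← ENNReal.ofReal_sum_of_nonneg (fun _ _ => h2 _ _)]
  rw [← ENNReal.ofReal_sum_of_nonneg (fun i _ => Finset.sum_nonneg fun _ _ => h2 _ _),
    ← ENNReal.ofReal_mul hρ0]
  unfold pairSum
  congr 1
  simp_rw [Finset.mul_sum]
  refine Finset.sum_congr rfl fun i _ => Finset.sum_congr rfl fun k _ => ?_
  split_ifs <;> ring

/-- The pairs of points on different arcs have mass `ρ * (ρ * pairSum)`. This is also what the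
estimates for the single excursions sum up to. -/
theorem ofReal_mul_pairSum_le (hρ : ∀ j, h.real (Q.branch j) = ρ * Q.len j) (hρ0 : 0 ≤ ρ)
    (hfb : ∀ j x, 0 ≤ x → x ≤ Q.len j →
      h.real (Q.near j x) * (x + Q.totalLength - Q.len j) ≤ ρ * Q.totalLength * x)
    (ht : ∀ᵐ p ∂h, S.time p ≠ ∞) :
    ENNReal.ofReal ρ * ENNReal.ofReal (ρ * Q.pairSum) =
        ∑' a : S.starts, 2 * (h (S.found a) * S.laterMassOff h a) ∧
      ∑' a : S.starts, 2 * (h (S.found a) * S.laterMassOff h a) ≤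
        ENNReal.ofReal ρ * ∑' a : S.starts, S.duration a * S.laterMass h a := by
  constructor
  · rw [← sum_pairs_branch hρ hρ0, ENNReal.tsum_mul_left]
    simp_rw [measure_branch_eq ht]
    exact (two_mul_tsum_pairs (fun a : S.starts => h (S.found a)) S.excursionArc).symm
  · rw [← ENNReal.tsum_mul_left]
    exact ENNReal.tsum_le_tsum fun a => two_mul_found_mul_le hρ hρ0 hfb ht a

/-- Against a forward biased balanced distribution no search is faster than the depth-first
searches. -/
theorem le_expectedTime (hρ : ∀ j, h.real (Q.branch j) = ρ * Q.len j) (hρ0 : 0 ≤ ρ)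
    (hfb : ∀ j x, 0 ≤ x → x ≤ Q.len j →
      h.real (Q.near j x) * (x + Q.totalLength - Q.len j) ≤ ρ * Q.totalLength * x) (S : Q.Search) :
    meanDist h + ENNReal.ofReal (ρ * Q.pairSum) ≤ S.expectedTime h := by
  by_cases hT : S.expectedTime h = ∞
  · rw [hT]; exact le_top
  have ht := ae_time_ne_top hT
  obtain ⟨h1, h2⟩ := ofReal_mul_pairSum_le hρ hρ0 hfb ht
  obtain ⟨h3, h4⟩ := tsum_found_mul_start ht
  rw [tsum_setLIntegral_add ht] at h3
  refine le_trans (add_le_add le_rfl ?_) h3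
  refine le_trans ?_ h4
  rcases hρ0.eq_or_lt with h0 | h0
  · simp [← h0]
  · rw [← h1] at h2
    exact (ENNReal.mul_le_mul_iff_right (by simpa using h0) ENNReal.ofReal_ne_top).1 h2

end Search

/-! ### Existence of an optimal search -/

namespace Search

/-- A sequence of searches has a subsequence that converges pointwise to a search. -/
theorem exists_tendsto_subseq (S : ℕ → Q.Search) : ∃ (S' : Q.Search) (φ : ℕ → ℕ), StrictMono φ ∧
    ∀ t, Filter.Tendsto (fun k => (S (φ k)).path t) Filter.atTop (nhds (S'.path t)) := by
  set f : ℕ → C(ℝ≥0, Q.Point) := fun k => ⟨(S k).path, (S k).continuous_path⟩ with hf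
  set A : Set C(ℝ≥0, Q.Point) := {g | g 0 = Q.root ∧ LipschitzWith 1 g} with hA
  have himage : ContinuousMap.toFun '' A =
      {g : ℝ≥0 → Q.Point | g 0 = Q.root ∧ LipschitzWith 1 g} := by
    ext g
    constructor
    · rintro ⟨g, hg, rfl⟩; exact hg
    · rintro hg; exact ⟨⟨g, hg.2.continuous⟩, hg, rfl⟩
  have hclosed : IsClosed {g : ℝ≥0 → Q.Point | g 0 = Q.root ∧ LipschitzWith 1 g} := by
    have : {g : ℝ≥0 → Q.Point | g 0 = Q.root ∧ LipschitzWith 1 g} =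
        {g | g 0 = Q.root} ∩ ⋂ s, ⋂ t, {g | dist (g s) (g t) ≤ dist s t} := by
      ext g
      simp [lipschitzWith_iff_dist_le_mul]
    rw [this]
    exact (isClosed_eq (continuous_apply 0) continuous_const).inter
      (isClosed_iInter fun s => isClosed_iInter fun t =>
        isClosed_le ((continuous_apply s).dist (continuous_apply t)) continuous_const)
  have hcomp : IsCompact A := by
    refine ArzelaAscoli.isCompact_of_equicontinuous A (himage ▸ hclosed.isCompact) ?_
    exact (LipschitzWith.uniformEquicontinuous _ 1 fun g => g.2.2).equicontinuous
  obtain ⟨g, hg, φ, hφ, hlim⟩ := hcomp.isSeqCompact (x := f)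
    (fun k => ⟨(S k).start, (S k).lipschitz⟩)
  refine ⟨⟨g, hg.1, hg.2⟩, φ, hφ, fun t => ?_⟩
  exact ((ContinuousEvalConst.continuous_eval_const t).tendsto g).comp hlim

/-- The search time is lower semicontinuous under pointwise convergence. -/
theorem time_le_liminf {S : ℕ → Q.Search} {S' : Q.Search}
    (hlim : ∀ t, Filter.Tendsto (fun k => (S k).path t) Filter.atTop (nhds (S'.path t)))
    (p : Q.Point) : S'.time p ≤ Filter.liminf (fun k => (S k).time p) Filter.atTop := by
  refine le_of_forall_gt fun c hc => ?_
  obtain ⟨c', hc1, hc2⟩ := exists_between hc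
  lift c' to ℝ≥0 using hc2.ne_top
  refine lt_of_le_of_lt ?_ hc2
  have hfreq : ∃ᶠ k in Filter.atTop, (S k).time p < c' := Filter.frequently_lt_of_liminf_lt
    (by isBoundedDefault) hc1
  obtain ⟨φ, hφ, hlt⟩ := Filter.extraction_of_frequently_atTop hfreq
  have hex : ∀ k, ∃ t ∈ Set.Icc (0 : ℝ≥0) c', (S (φ k)).path t = p := fun k => by
    obtain ⟨t, ht, h⟩ := time_le_iff.1 (hlt k).le
    exact ⟨t, ⟨bot_le, ht⟩, h⟩
  choose t ht htp using hex
  obtain ⟨u, hu, ψ, hψ, hu'⟩ := isCompact_Icc.isSeqCompact ht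
  -- along the subsequence, the searches are close to `p` at the limit time `u`
  have hd : Filter.Tendsto (fun k => dist ((S (φ (ψ k))).path u) p) Filter.atTop (nhds 0) := by
    refine squeeze_zero (fun _ => dist_nonneg) (g := fun k => dist (t (ψ k)) u) (fun k => ?_)
      (tendsto_iff_dist_tendsto_zero.1 hu')
    have := (S (φ (ψ k))).dist_path_le u (t (ψ k))
    rwa [htp, ← NNReal.dist_eq, dist_comm u] at this
  have hp := tendsto_iff_dist_tendsto_zero.2 hd
  have hS' := (hlim u).comp (hφ.tendsto_atTop.comp hψ.tendsto_atTop)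
  exact (time_le (tendsto_nhds_unique hS' hp)).trans (ENNReal.coe_le_coe.2 hu.2)

/-- Every hiding distribution has an optimal search. -/
theorem exists_isOptimal (h : Measure Q.Point) : ∃ S : Q.Search, S.IsOptimal h := by
  set V : ℝ≥0∞ := ⨅ S : Q.Search, S.expectedTime h with hV
  have hne : (Set.range fun S : Q.Search => S.expectedTime h).Nonempty :=
    ⟨_, ⟨fun _ => Q.root, rfl, LipschitzWith.const' _⟩, rfl⟩
  obtain ⟨u, -, hu, hmem⟩ := exists_seq_tendsto_sInf hne (OrderBot.bddBelow _)
  choose S hS using hmem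
  obtain ⟨S', φ, hφ, hlim⟩ := exists_tendsto_subseq S
  refine ⟨S', fun T => ?_⟩
  calc S'.expectedTime h
      ≤ ∫⁻ p, Filter.liminf (fun k => (S (φ k)).time p) Filter.atTop ∂h :=
        lintegral_mono fun p => time_le_liminf hlim p
    _ ≤ Filter.liminf (fun k => (S (φ k)).expectedTime h) Filter.atTop :=
        lintegral_liminf_le fun k => (S (φ k)).measurable_time
    _ = sInf (Set.range fun S : Q.Search => S.expectedTime h) := by
        have := (hu.comp hφ.tendsto_atTop).liminf_eq
        rw [← this]
        congr 1
        ext k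
        exact hS (φ k)
    _ ≤ T.expectedTime h := sInf_le ⟨T, rfl⟩

end Search

/-! ### Searches that attain the lower bound -/

/-- Geodesics of the star are unique: a point between the root and a leaf in the metric sense lies
on the arc of the leaf. -/
theorem eq_pt_of_dist_le {j : Fin Q.n} {s : ℝ} (h0 : 0 ≤ s) (h1 : s ≤ Q.len j) {q : Q.Point}
    (hq : dist Q.root q ≤ s) (hq' : dist q (Q.pt j (Q.len j)) ≤ Q.len j - s) : q = Q.pt j s := by
  have hl := Q.len_pos j
  by_cases hj : q ∈ Q.arc j
  · rw [dist_of_mem_arc hj (pt_mem_arc _ _), pt_coord_of_mem hl.le le_rfl] at hq'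
    rw [dist_root_of_mem_arc hj] at hq
    refine ext_of_mem_arc hj (pt_mem_arc _ _) ?_
    rw [pt_coord_of_mem h0 h1]
    linarith [(abs_le.1 hq').1]
  · obtain ⟨i, hi⟩ := exists_mem_arc q
    have hij : i ≠ j := fun h => hj (h ▸ hi)
    rw [dist_of_mem_arc_ne hij hi (pt_mem_arc _ _), dist_root_pt hl.le le_rfl] at hq'
    have : dist Q.root q = 0 := le_antisymm (by linarith) dist_nonneg
    exact absurd (dist_eq_zero.1 this ▸ root_mem_arc j) hj

namespace Search

/-- A search that is at the root when each tour starts and at the leaf half-way through the tour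
has no choice in between. -/
theorem agree_of_leaves {S S' : Q.Search} {σ : Equiv.Perm (Fin Q.n)} (hS' : S'.Follows σ)
    (hroot : ∀ (k : Fin Q.n) (t : ℝ≥0), (t : ℝ) = tourStart σ k → S.path t = Q.root)
    (hleaf : ∀ (k : Fin Q.n) (t : ℝ≥0), (t : ℝ) = tourStart σ k + Q.len (σ k) →
      S.path t = Q.pt (σ k) (Q.len (σ k))) : S.AgreeUntilCovered S' := by
  have hn := Q.two_le_n
  set l : Fin Q.n := ⟨Q.n - 1, by omega⟩ with hl
  have hkl : ∀ k : Fin Q.n, k ≤ l := fun k => by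
    rw [Fin.le_def]; simp only [hl]; have := k.2; omega
  have hM0 : 0 ≤ tourStart σ l + Q.len (σ l) := add_nonneg (tourStart_nonneg σ l) (Q.len_pos _).le
  have hagree : ∀ t : ℝ≥0, (t : ℝ) ≤ tourStart σ l + Q.len (σ l) → S.path t = S'.path t := by
    intro t ht
    have htot := tourStart_add_le_total σ l
    have hlen := Q.len_pos (σ l)
    obtain ⟨k, -, h1, h2⟩ := exists_tour σ t.coe_nonneg le_rfl
      (show (t : ℝ) < tourTime σ Q.n by rw [tourTime_n]; linarith)
    have hk := tourStart_nonneg σ k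
    have hlk := Q.len_pos (σ k)
    obtain ⟨u, hu⟩ : ∃ u : ℝ≥0, (u : ℝ) = tourStart σ k + Q.len (σ k) :=
      ⟨⟨_, by linarith⟩, rfl⟩
    have hut := S.dist_path_le t u
    rw [hleaf k u hu, hu] at hut
    rw [hS' k t h1 h2.le]
    rcases le_or_gt (t : ℝ) (tourStart σ k + Q.len (σ k)) with h3 | h3
    · rw [min_eq_left (by linarith)]
      obtain ⟨v, hv⟩ : ∃ v : ℝ≥0, (v : ℝ) = tourStart σ k := ⟨⟨_, hk⟩, rfl⟩
      have h4 := S.dist_path_le v t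
      rw [hroot k v hv, hv, abs_sub_comm, abs_of_nonneg (by linarith)] at h4
      rw [abs_sub_comm, abs_of_nonneg (by linarith)] at hut
      exact eq_pt_of_dist_le (by linarith) (by linarith) h4 (by linarith)
    · rw [min_eq_right (by linarith)]
      have hlt : k < l := lt_of_le_of_ne (hkl k) fun h => by rw [h] at h3; linarith
      have hk1 : k.val + 1 < Q.n := by rw [Fin.lt_def] at hlt; simp only [hl] at hlt; omega
      have hnext : tourStart σ ⟨k.val + 1, hk1⟩ = tourStart σ k + 2 * Q.len (σ k) := by
        rw [← tourTime_succ, ← tourTime_coe]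
      obtain ⟨v, hv⟩ : ∃ v : ℝ≥0, (v : ℝ) = tourStart σ k + 2 * Q.len (σ k) :=
        ⟨⟨_, by linarith⟩, rfl⟩
      have h4 := S.dist_path_le v t
      rw [hroot ⟨k.val + 1, hk1⟩ v (hv.trans hnext.symm), hv, abs_of_nonneg (by linarith)] at h4
      rw [abs_of_nonneg (by linarith)] at hut
      exact eq_pt_of_dist_le (by linarith) (by linarith) h4 (by linarith)
  refine ⟨⟨tourStart σ l + Q.len (σ l), hM0⟩, Set.eq_univ_of_forall fun p => ?_,
    fun t ht => hagree t ht⟩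
  obtain ⟨j, hj⟩ := exists_mem_arc p
  obtain ⟨k, rfl⟩ := σ.surjective j
  have hd0 : 0 ≤ dist Q.root p := dist_nonneg
  have hd := dist_root_le_len hj
  have hk := tourStart_nonneg σ k
  have hle : tourStart σ k + dist Q.root p ≤ tourStart σ l + Q.len (σ l) := by
    rcases (hkl k).eq_or_lt with h | h
    · rw [← h]; linarith
    · have := tourStart_add_le σ h
      have := Q.len_pos (σ k)
      have := Q.len_pos (σ l)
      linarith
  obtain ⟨v, hv⟩ : ∃ v : ℝ≥0, (v : ℝ) = tourStart σ k + dist Q.root p :=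
    ⟨⟨_, by linarith⟩, rfl⟩
  rw [← hv] at hle
  refine ⟨v, ⟨bot_le, hle⟩, ?_⟩
  rw [hagree v hle, hS' k v (by linarith) (by linarith), hv, min_eq_left (by linarith),
    add_sub_cancel_left, pt_eq hj]

/-- Two different excursions cannot both find the whole mass of a branch. -/
theorem eq_of_excursionArc_eq {S : Q.Search} {h : Measure Q.Point} [IsFiniteMeasure h]
    {a b : S.starts}
    (ha : h (S.found a) = h (Q.branch (S.excursionArc a)))
    (hb : h (S.found b) = h (Q.branch (S.excursionArc b)))
    (hab : S.excursionArc a = S.excursionArc b) (h0 : h (S.found a) ≠ 0) : a = b := by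
  by_contra hne
  have h1 : h (S.found a ∪ S.found b) ≤ h (Q.branch (S.excursionArc a)) :=
    measure_mono (Set.union_subset (found_subset_branch a) (hab ▸ found_subset_branch b))
  rw [measure_union (pairwise_disjoint_found hne) (measurableSet_found _), hb, ← hab, ← ha] at h1
  have h2 := ENNReal.lt_add_right (measure_ne_top h (S.found a)) h0
  exact absurd h1 (not_le.2 h2)

/-- Here `D`, `R`, `U`, `d` stand for the masses `found`, `laterMass` and `laterMassOff` and the
duration of an excursion with farthest discovery at distance `x`, on an arc of length `l` in a star
of total length `m`, and `G` for the mass of the branch up to `x`. If the estimate behind the lower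
bound is sharp, the excursion reaches the leaf, finds the mass of the whole branch, and lasts no
longer than a tour of the arc. -/
theorem eq_of_sharp {ρ x l m d D G R U : ℝ} (hρ : 0 < ρ) (hx0 : 0 < x) (hxl : x ≤ l)
    (hlm : l < m)
    (hG : x < l → G * (x + m - l) < ρ * m * x) (hGl : G ≤ ρ * l) (hD : D ≤ G)
    (hR : U + ρ * l - G ≤ R) (hU : U ≤ ρ * (m - l)) (hU0 : 0 ≤ U) (hUR : U ≤ R) (hR0 : 0 < R)
    (hd : 2 * x ≤ d) (heq : 2 * (D * U) = ρ * (d * R)) : D = ρ * l ∧ d = 2 * l := by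
  have h1 : ρ * (x * R) ≤ D * U := by
    have : ρ * (2 * x * R) ≤ ρ * (d * R) :=
      mul_le_mul_of_nonneg_left (mul_le_mul_of_nonneg_right hd hR0.le) hρ.le
    linarith
  have hUpos : 0 < U := by
    refine hU0.lt_of_ne fun h => ?_
    rw [← h, mul_zero] at h1
    have : 0 < ρ * (x * R) := by positivity
    linarith
  -- inside the arc the strict forward bound would make the estimate strict
  have hx : x = l := by
    by_contra hne
    have hlt := lt_of_le_of_ne hxl hne
    have h2 : D * U ≤ G * U := mul_le_mul_of_nonneg_right hD hU0
    have h3 : ρ * (x * (U + ρ * l - G)) ≤ ρ * (x * R) := by gcongr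
    have h4 : 0 ≤ x * ((ρ * (m - l) - U) * (ρ * l - G)) :=
      mul_nonneg hx0.le (mul_nonneg (by linarith) (by linarith))
    have h5 : 0 < U * (ρ * m * x - G * (x + m - l)) := mul_pos hUpos (by linarith [hG hlt])
    have h6 : (m - l) * (ρ * (x * (U + ρ * l - G))) ≤ (m - l) * (G * U) :=
      mul_le_mul_of_nonneg_left (by linarith) (by linarith)
    linarith
  subst hx
  have h2 : U * (ρ * x) ≤ U * D := by
    have : ρ * (x * U) ≤ ρ * (x * R) := by gcongr
    linarith
  have hDe : D = ρ * x := le_antisymm (hD.trans hGl) (le_of_mul_le_mul_left h2 hUpos)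
  refine ⟨hDe, le_antisymm ?_ hd⟩
  rw [hDe] at heq
  have h3 : ρ * R * d ≤ ρ * R * (2 * x) := by
    have : ρ * (x * U) ≤ ρ * (x * R) := by gcongr
    linarith
  exact le_of_mul_le_mul_left h3 (by positivity)

variable {S : Q.Search} {h : Measure Q.Point} {ρ : ℝ} [IsFiniteMeasure h]

/-- If a search attains the lower bound, every step of its proof is sharp: points are found without
loss of time during their excursions, an excursion that finds something is preceded by no time at
the root except a null set, and the estimates for the single excursions are equalities. -/
theorem equality_conditions (hρ : ∀ j, h.real (Q.branch j) = ρ * Q.len j) (hρ0 : 0 < ρ)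
    (hfb : ∀ j x, 0 ≤ x → x ≤ Q.len j →
      h.real (Q.near j x) * (x + Q.totalLength - Q.len j) ≤ ρ * Q.totalLength * x)
    (hS : S.expectedTime h ≤ meanDist h + ENNReal.ofReal (ρ * Q.pairSum)) (a : S.starts) :
    (∀ᵐ p ∂h.restrict (S.found a),
        ((a : ℝ≥0) : ℝ≥0∞) + ENNReal.ofReal (dist Q.root p) = S.time p) ∧
      (h (S.found a) ≠ 0 →
        ((a : ℝ≥0) : ℝ≥0∞) = ∑' b : S.starts, if b < a then S.duration b else 0) ∧
      2 * (h (S.found a) * S.laterMassOff h a) =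
        ENNReal.ofReal ρ * (S.duration a * S.laterMass h a) := by
  have hmd := meanDist_ne_top h
  have hVtop : meanDist h + ENNReal.ofReal (ρ * Q.pairSum) ≠ ∞ :=
    ENNReal.add_ne_top.2 ⟨hmd, ENNReal.ofReal_ne_top⟩
  have ht := ae_time_ne_top (ne_top_of_le_ne_top hVtop hS)
  obtain ⟨h1, h2⟩ := ofReal_mul_pairSum_le hρ hρ0.le hfb ht
  obtain ⟨h3, h4⟩ := tsum_found_mul_start ht
  have hρ' : ENNReal.ofReal ρ ≠ 0 := by simpa using hρ0
  -- all members of the chain of inequalities are equal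
  have h5 : ∑' a : S.starts, h (S.found a) * (a : ℝ≥0) ≤ ENNReal.ofReal (ρ * Q.pairSum) := by
    have := h3.trans hS
    rw [tsum_setLIntegral_add ht] at this
    exact (ENNReal.add_le_add_iff_left hmd).1 this
  have h6 : ENNReal.ofReal (ρ * Q.pairSum) ≤ ∑' a : S.starts, S.duration a * S.laterMass h a := by
    rw [← h1] at h2
    exact (ENNReal.mul_le_mul_iff_right hρ' ENNReal.ofReal_ne_top).1 h2
  refine ⟨?_, fun ha => ?_, ?_⟩
  · have hX : ∑' a : S.starts, ∫⁻ p in S.found a, ((a : ℝ≥0) + ENNReal.ofReal (dist Q.root p)) ∂h =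
        meanDist h + ENNReal.ofReal (ρ * Q.pairSum) := by
      rw [tsum_setLIntegral_add ht, le_antisymm h5 (h6.trans h4)]
    have hle : ∀ a : S.starts, ∀ p ∈ S.found a,
        ((a : ℝ≥0) : ℝ≥0∞) + ENNReal.ofReal (dist Q.root p) ≤ S.time p :=
      fun a p hp => le_time_of_mem_found a.2.1 hp
    have heq := eq_of_tsum_le (by rw [hX]; exact hVtop)
      (fun a : S.starts => setLIntegral_mono' (μ := h) (measurableSet_found (a : ℝ≥0)) (hle a))
      (by rw [hX, ← lintegral_found ht, ← StarNetwork.expectedTime_eq]; exact hS) a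
    refine ae_eq_of_ae_le_of_lintegral_le ?_ ?_ S.measurable_time.aemeasurable heq.ge
    · exact (ae_restrict_iff' (measurableSet_found _)).2 (Filter.Eventually.of_forall (hle a))
    · exact ne_top_of_le_ne_top hVtop (hX ▸ ENNReal.le_tsum a)
  · have hle : ∀ a : S.starts,
        h (S.found a) * (∑' b : S.starts, if b < a then S.duration b else 0) ≤
          h (S.found a) * (a : ℝ≥0) := fun a => mul_le_mul_right (tsum_duration_le a) _
    have hsum : ∑' a : S.starts, h (S.found a) *
        (∑' b : S.starts, if b < a then S.duration b else 0) =
        ∑' a : S.starts, S.duration a * S.laterMass h a := tsum_mul_tsum_lt _ _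
    have heq := eq_of_tsum_le (by
      rw [hsum]; exact ne_top_of_le_ne_top ENNReal.ofReal_ne_top (h4.trans h5)) hle
      (by rw [hsum]; exact h5.trans h6) a
    exact ((ENNReal.mul_right_inj ha (measure_ne_top _ _)).1 heq).symm
  · refine eq_of_tsum_le ?_ (fun a => two_mul_found_mul_le hρ hρ0.le hfb ht a) ?_ a
    · rw [← h1]; exact ENNReal.mul_ne_top ENNReal.ofReal_ne_top ENNReal.ofReal_ne_top
    · rw [← h1, ENNReal.tsum_mul_left]
      exact mul_le_mul_right (h4.trans h5) _

/-- In a search that attains the lower bound, an excursion after which there is still something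
to find is a complete tour of its arc. -/
theorem complete_of_laterMass_ne_zero (hρ : ∀ j, h.real (Q.branch j) = ρ * Q.len j) (hρ0 : 0 < ρ)
    (hfb : ∀ j x, 0 ≤ x → x ≤ Q.len j →
      h.real (Q.near j x) * (x + Q.totalLength - Q.len j) ≤ ρ * Q.totalLength * x)
    (hsfb : ∀ j x, 0 < x → x < Q.len j →
      h.real (Q.near j x) * (x + Q.totalLength - Q.len j) < ρ * Q.totalLength * x)
    (hS : S.expectedTime h ≤ meanDist h + ENNReal.ofReal (ρ * Q.pairSum)) (a : S.starts)
    (ha : S.laterMass h a ≠ 0) : h (S.found a) = h (Q.branch (S.excursionArc a)) ∧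
      S.duration a = ENNReal.ofReal (2 * Q.len (S.excursionArc a)) := by
  have hVtop : meanDist h + ENNReal.ofReal (ρ * Q.pairSum) ≠ ∞ :=
    ENNReal.add_ne_top.2 ⟨meanDist_ne_top h, ENNReal.ofReal_ne_top⟩
  have ht := ae_time_ne_top (ne_top_of_le_ne_top hVtop hS)
  have heq := (equality_conditions hρ hρ0 hfb hS a).2.2
  have hρ' : ENNReal.ofReal ρ ≠ 0 := by simpa using hρ0
  have hdur : S.duration a ≠ ∞ := by
    intro htop
    rw [htop, ENNReal.top_mul ha, ENNReal.mul_top hρ'] at heq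
    exact ENNReal.mul_ne_top (by simp) (ENNReal.mul_ne_top (measure_ne_top _ _)
      (laterMassOff_ne_top a)) heq
  have hfound : h (S.found a) ≠ 0 := by
    intro h0
    rw [h0, zero_mul, mul_zero] at heq
    exact mul_ne_zero hρ' (mul_ne_zero (duration_pos a).ne' ha) heq.symm
  obtain ⟨x, hx0, hxl, hd, hD, hR, hU⟩ := exists_reach hρ ht a hfound
  have heq' := congrArg ENNReal.toReal heq
  simp only [ENNReal.toReal_mul, ENNReal.toReal_ofNat, ENNReal.toReal_ofReal hρ0.le] at heq'
  obtain ⟨h1, h2⟩ := eq_of_sharp hρ0 hx0 hxl (len_lt_totalLength _)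
    (fun hlt => hsfb _ x hx0 hlt)
    ((measureReal_mono (near_subset_branch _ _)).trans_eq (hρ _)) hD hR hU
    ENNReal.toReal_nonneg (ENNReal.toReal_mono (laterMass_ne_top a) (laterMassOff_le a))
    (ENNReal.toReal_pos ha (laterMass_ne_top a))
    ((ENNReal.ofReal_le_iff_le_toReal hdur).1 hd) heq'
  exact ⟨by rw [measure_branch hρ, ← h1, ENNReal.ofReal_toReal (measure_ne_top _ _)],
    by rw [← h2, ENNReal.ofReal_toReal hdur]⟩

/-- In a search that attains the lower bound, each branch has an excursion that finds its whole
mass. -/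
theorem exists_complete (hρ : ∀ j, h.real (Q.branch j) = ρ * Q.len j) (hρ0 : 0 < ρ)
    (hfb : ∀ j x, 0 ≤ x → x ≤ Q.len j →
      h.real (Q.near j x) * (x + Q.totalLength - Q.len j) ≤ ρ * Q.totalLength * x)
    (hsfb : ∀ j x, 0 < x → x < Q.len j →
      h.real (Q.near j x) * (x + Q.totalLength - Q.len j) < ρ * Q.totalLength * x)
    (hS : S.expectedTime h ≤ meanDist h + ENNReal.ofReal (ρ * Q.pairSum)) (j : Fin Q.n) :
    ∃ a : S.starts, S.excursionArc a = j ∧ h (S.found a) = h (Q.branch j) := by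
  have hVtop : meanDist h + ENNReal.ofReal (ρ * Q.pairSum) ≠ ∞ :=
    ENNReal.add_ne_top.2 ⟨meanDist_ne_top h, ENNReal.ofReal_ne_top⟩
  have ht := ae_time_ne_top (ne_top_of_le_ne_top hVtop hS)
  have hcomp := complete_of_laterMass_ne_zero hρ hρ0 hfb hsfb hS
  have hpos : h (Q.branch j) ≠ 0 := by
    rw [measure_branch hρ]
    simpa using mul_pos hρ0 (Q.len_pos j)
  have hsum := measure_branch_eq ht j
  obtain ⟨a, ha⟩ : ∃ a : S.starts, (if S.excursionArc a = j then h (S.found a) else 0) ≠ 0 := by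
    by_contra! hcon
    simp only [hcon, tsum_zero] at hsum
    exact hpos hsum
  have haj : S.excursionArc a = j := by
    by_contra hne
    exact ha (if_neg hne)
  rw [if_pos haj] at ha
  refine ⟨a, haj, ?_⟩
  by_cases hlater : S.laterMass h a = 0
  · -- nothing is found after `a`, and earlier excursions to the arc would have found everything
    rw [hsum, tsum_eq_single a, if_pos haj]
    intro b hb
    by_cases hbj : S.excursionArc b = j
    · rw [if_pos hbj]
      rcases lt_or_gt_of_ne hb with hlt | hlt
      · exfalso
        have h1 : S.laterMass h b ≠ 0 := fun h0 =>
          ha (le_antisymm ((le_laterMass hlt).trans h0.le) bot_le)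
        have h2 := (hcomp b h1).1
        have h3 : h (S.found a ∪ S.found b) ≤ h (Q.branch j) :=
          measure_mono (Set.union_subset (haj ▸ found_subset_branch a)
            (hbj ▸ found_subset_branch b))
        rw [measure_union (pairwise_disjoint_found hb.symm) (measurableSet_found _), h2, hbj,
          add_comm] at h3
        exact absurd h3 (not_le.2 (ENNReal.lt_add_right (measure_ne_top _ _) ha))
      · exact le_antisymm ((le_laterMass hlt).trans hlater.le) bot_le
    · exact if_neg hbj
  · rw [(hcomp a hlater).1, haj]

/-- An excursion that finds the whole mass of a branch without loss of time goes straight to the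
leaf. -/
theorem path_leaf (hρ : ∀ j, h.real (Q.branch j) = ρ * Q.len j) (hρ0 : 0 < ρ)
    (hsfb : ∀ j x, 0 < x → x < Q.len j →
      h.real (Q.near j x) * (x + Q.totalLength - Q.len j) < ρ * Q.totalLength * x)
    {a : S.starts} {j : Fin Q.n} (ha : h (S.found a) = h (Q.branch j))
    (haj : S.excursionArc a = j)
    (hae : ∀ᵐ p ∂h.restrict (S.found a),
      ((a : ℝ≥0) : ℝ≥0∞) + ENNReal.ofReal (dist Q.root p) = S.time p)
    {t : ℝ≥0} (ht : (t : ℝ) = (a : ℝ≥0) + Q.len j) : S.path t = Q.pt j (Q.len j) := by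
  have hl := Q.len_pos j
  have hμ := len_lt_totalLength j
  rw [← dist_eq_zero]
  refine le_antisymm (le_of_forall_pos_le_add fun ε hε => ?_) dist_nonneg
  -- a point near the leaf that is found without loss of time
  set x : ℝ := max (Q.len j / 2) (Q.len j - ε / 2) with hx
  have hx0 : 0 < x := lt_max_of_lt_left (by linarith)
  have hxl : x < Q.len j := max_lt (by linarith) (by linarith)
  have hG : h.real (Q.near j x) < ρ * Q.len j := by
    have h1 := hsfb j x hx0 hxl
    have h2 : 0 < ρ * ((Q.totalLength - Q.len j) * (Q.len j - x)) :=
      mul_pos hρ0 (mul_pos (by linarith) (by linarith))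
    have h3 : (x + Q.totalLength - Q.len j) * h.real (Q.near j x) <
        (x + Q.totalLength - Q.len j) * (ρ * Q.len j) := by linarith
    exact lt_of_mul_lt_mul_left h3 (by linarith)
  have hne : h.restrict (S.found a) (Q.near j x)ᶜ ≠ 0 := by
    rw [Measure.restrict_apply (measurableSet_near _ _).compl]
    intro h0
    have h1 : h (S.found a) ≤ h (Q.near j x) := by
      rw [← measure_inter_add_sdiff (S.found a) (measurableSet_near j x), Set.sdiff_eq,
        Set.inter_comm (S.found a) (Q.near j x)ᶜ, h0, add_zero]
      exact measure_mono Set.inter_subset_right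
    rw [ha] at h1
    have h2 := ENNReal.toReal_mono (measure_ne_top _ _) h1
    exact absurd (hρ j ▸ h2) (not_le.2 hG)
  have hfreq : ∃ᵐ p ∂h.restrict (S.found a), p ∈ (Q.near j x)ᶜ := by
    rw [frequently_ae_iff]; exact hne
  obtain ⟨p, hpx, hpt, hpf⟩ := (hfreq.and_eventually
    (hae.and (ae_restrict_mem (measurableSet_found _)))).exists
  have hpb : p ∈ Q.branch j := haj ▸ found_subset_branch a hpf
  have hdx : x < dist Q.root p := by
    by_contra hcon
    exact hpx ⟨hpb, not_lt.1 hcon⟩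
  have hdl := dist_root_le_len hpb.1
  obtain ⟨s, -, hs⟩ := hpf
  have hsp := path_eq_of_time_eq hs
  have hsa : (s : ℝ) = (a : ℝ≥0) + dist Q.root p := by
    rw [hs] at hpt
    have := congrArg ENNReal.toReal hpt
    rw [ENNReal.toReal_add ENNReal.coe_ne_top ENNReal.ofReal_ne_top,
      ENNReal.toReal_ofReal dist_nonneg, ENNReal.coe_toReal, ENNReal.coe_toReal] at this
    exact this.symm
  have h1 := S.dist_path_le t s
  have h2 : dist p (Q.pt j (Q.len j)) = Q.len j - dist Q.root p := by
    rw [dist_of_mem_arc hpb.1 (pt_mem_arc _ _), pt_coord_of_mem hl.le le_rfl,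
      dist_root_of_mem_arc hpb.1, abs_sub_comm, abs_of_nonneg]
    linarith [dist_root_of_mem_arc hpb.1]
  rw [hsp, ht, hsa, abs_of_nonneg (by linarith)] at h1
  have h3 : Q.len j - ε / 2 ≤ x := le_max_right _ _
  linarith [dist_triangle (S.path t) p (Q.pt j (Q.len j))]

/-- Against a strictly forward biased balanced distribution, a search that attains the lower bound
is depth-first until it has covered the star. -/
theorem exists_agree (hρ : ∀ j, h.real (Q.branch j) = ρ * Q.len j) (hρ0 : 0 < ρ)
    (hfb : ∀ j x, 0 ≤ x → x ≤ Q.len j →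
      h.real (Q.near j x) * (x + Q.totalLength - Q.len j) ≤ ρ * Q.totalLength * x)
    (hsfb : ∀ j x, 0 < x → x < Q.len j →
      h.real (Q.near j x) * (x + Q.totalLength - Q.len j) < ρ * Q.totalLength * x)
    (hS : S.expectedTime h ≤ meanDist h + ENNReal.ofReal (ρ * Q.pairSum)) :
    ∃ S' : Q.Search, S'.IsDepthFirst ∧ S.AgreeUntilCovered S' := by
  choose A hAj hA using exists_complete hρ hρ0 hfb hsfb hS
  have hpos : ∀ j, h (Q.branch j) ≠ 0 := fun j => by
    rw [measure_branch hρ]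
    simpa using mul_pos hρ0 (Q.len_pos j)
  have hAinj : Function.Injective A := fun i j hij => by rw [← hAj i, ← hAj j, hij]
  set σ : Equiv.Perm (Fin Q.n) := Tuple.sort A with hσ
  have hmono : StrictMono (A ∘ σ) :=
    (Tuple.monotone_sort A).strictMono_of_injective (hAinj.comp σ.injective)
  have hstart : ∀ k, ((A (σ k) : ℝ≥0) : ℝ) = tourStart σ k := by
    intro k
    have h1 := (equality_conditions hρ hρ0 hfb hS (A (σ k))).2.1 (by rw [hA]; exact hpos _)
    -- all earlier excursions are complete tours
    have hearlier : ∀ b : S.starts, b < A (σ k) → A (S.excursionArc b) = b ∧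
        S.duration b = ENNReal.ofReal (2 * Q.len (S.excursionArc b)) := by
      intro b hb
      have hlater : S.laterMass h b ≠ 0 := fun h0 => hpos (σ k)
        (le_antisymm ((hA (σ k)).symm.le.trans ((le_laterMass hb).trans h0.le)) bot_le)
      obtain ⟨h2, h3⟩ := complete_of_laterMass_ne_zero hρ hρ0 hfb hsfb hS b hlater
      refine ⟨eq_of_excursionArc_eq (h := h) ?_ h2 (hAj _) ?_, h3⟩
      · rw [hA, hAj]
      · rw [hA]; exact hpos _
    have h2 : ∑' b : S.starts, (if b < A (σ k) then S.duration b else 0) =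
        ∑' i : Fin Q.n, (if A (σ i) < A (σ k) then S.duration (A (σ i)) else 0) := by
      refine ((hAinj.comp σ.injective).tsum_eq (g := A ∘ σ)
        (f := fun b : S.starts => if b < A (σ k) then S.duration b else 0) ?_).symm
      intro b hb
      have hlt : b < A (σ k) := by
        by_contra hcon
        exact hb (if_neg hcon)
      exact ⟨σ.symm (S.excursionArc b), by simp [(hearlier b hlt).1]⟩
    have h3 : ∀ i, (if A (σ i) < A (σ k) then S.duration (A (σ i)) else 0) =
        ENNReal.ofReal (if i < k then 2 * Q.len (σ i) else 0) := by
      intro i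
      have : A (σ i) < A (σ k) ↔ i < k := hmono.lt_iff_lt (a := i) (b := k)
      by_cases hik : i < k
      · rw [if_pos (this.2 hik), if_pos hik, (hearlier _ (this.2 hik)).2, hAj]
      · rw [if_neg fun h => hik (this.1 h), if_neg hik, ENNReal.ofReal_zero]
    rw [h2, tsum_fintype] at h1
    simp_rw [h3] at h1
    have h4 : ∀ i, 0 ≤ if i < k then 2 * Q.len (σ i) else 0 := fun i => by
      have := Q.len_pos (σ i)
      split_ifs <;> linarith
    rw [← ENNReal.ofReal_sum_of_nonneg (fun i _ => h4 i)] at h1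
    have h5 := congrArg ENNReal.toReal h1
    rw [ENNReal.toReal_ofReal (Finset.sum_nonneg fun i _ => h4 i), ENNReal.coe_toReal] at h5
    rw [h5, tourStart, Finset.mul_sum, ← Finset.sum_filter]
    congr 1
    ext i; simp
  obtain ⟨S', hS'⟩ := exists_follows σ
  refine ⟨S', isDepthFirst_iff.2 ⟨σ, hS'⟩, agree_of_leaves hS' (fun k t ht => ?_) fun k t ht => ?_⟩
  · have : t = A (σ k) := NNReal.coe_injective (ht.trans (hstart k).symm)
    rw [this]
    exact (A (σ k)).2.1
  · exact path_leaf hρ hρ0 hsfb (hA _) (hAj _) (equality_conditions hρ hρ0 hfb hS _).1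
      (by rw [ht, hstart])

end Search

/-! ### Forward biased distributions -/

theorem Balanced.exists_density {h : Measure Q.Point} (hbal : Balanced h) :
    ∃ ρ : ℝ, 0 ≤ ρ ∧ ∀ j, h.real (Q.branch j) = ρ * Q.len j := by
  have h0 : 0 < Q.n := by have := Q.two_le_n; omega
  refine ⟨branchDensity h ⟨0, h0⟩, div_nonneg measureReal_nonneg (Q.len_pos _).le, fun j => ?_⟩
  rw [hbal ⟨0, h0⟩ j]
  exact (div_mul_cancel₀ _ (Q.len_pos j).ne').symm

theorem pairSum_pos (Q : StarNetwork) : 0 < Q.pairSum := by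
  have hn := Q.two_le_n
  have h1 : ∀ i k, 0 ≤ if i ≠ k then Q.len i * Q.len k else 0 := fun i k => by
    split_ifs
    · exact (mul_pos (Q.len_pos i) (Q.len_pos k)).le
    · exact le_rfl
  refine Finset.sum_pos' (fun i _ => Finset.sum_nonneg fun k _ => h1 i k)
    ⟨⟨0, by omega⟩, Finset.mem_univ _, ?_⟩
  refine Finset.sum_pos' (fun k _ => h1 _ k) ⟨⟨1, by omega⟩, Finset.mem_univ _, ?_⟩
  rw [if_pos (by simp)]
  exact mul_pos (Q.len_pos _) (Q.len_pos _)

section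

variable {h : Measure Q.Point} [IsProbabilityMeasure h] {ρ : ℝ}

theorem measureReal_root (hρ : ∀ j, h.real (Q.branch j) = ρ * Q.len j) :
    h.real {Q.root} = 1 - ρ * Q.totalLength := by
  have h1 := measureReal_compl (μ := h) (measurableSet_singleton Q.root)
  rw [← iUnion_branch, measureReal_iUnion_fintype (fun i j hij => branch_disjoint hij)
    measurableSet_branch, probReal_univ] at h1
  simp_rw [hρ, ← Finset.mul_sum] at h1
  unfold totalLength
  linarith

theorem arcCdf_eq (hρ : ∀ j, h.real (Q.branch j) = ρ * Q.len j) (j : Fin Q.n) {x : ℝ}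
    (hx : 0 ≤ x) : arcCdf h j x = 1 - ρ * Q.totalLength + h.real (Q.near j x) := by
  have : {p | p ∈ Q.arc j ∧ dist Q.root p ≤ x} = {Q.root} ∪ Q.near j x := by
    ext p
    constructor
    · rintro ⟨h1, h2⟩
      by_cases hp : p = Q.root
      · exact Or.inl hp
      · exact Or.inr ⟨⟨h1, hp⟩, h2⟩
    · rintro (hp | hp)
      · rw [Set.mem_singleton_iff.1 hp]
        exact ⟨root_mem_arc j, by rwa [dist_self]⟩
      · exact ⟨hp.1.1, hp.2⟩
  rw [arcCdf, this, measureReal_union _ (measurableSet_near j x), measureReal_root hρ]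
  rw [Set.disjoint_singleton_left]
  exact fun hp => hp.1.2 rfl

theorem forwardBound_eq (hρ : ∀ j, h.real (Q.branch j) = ρ * Q.len j) (j : Fin Q.n) (x : ℝ) :
    forwardBound h j x = (x + (Q.totalLength - Q.len j) * (1 - ρ * Q.totalLength)) /
      (x + Q.totalLength - Q.len j) := by
  have h1 : 0 ≤ 1 - ρ * Q.totalLength := measureReal_root hρ ▸ measureReal_nonneg
  have h2 := len_lt_totalLength j
  have h3 : arcCdf h j (Q.len j) * Q.totalLength - Q.len j =
      (Q.totalLength - Q.len j) * (1 - ρ * Q.totalLength) := by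
    rw [arcCdf_eq hρ j (Q.len_pos j).le, near_len, hρ]
    ring
  rw [forwardBound, h3, max_eq_left (mul_nonneg (by linarith) h1)]

theorem arcCdf_le_iff (hρ : ∀ j, h.real (Q.branch j) = ρ * Q.len j) (j : Fin Q.n) {x : ℝ}
    (hx : 0 ≤ x) : arcCdf h j x ≤ forwardBound h j x ↔
      h.real (Q.near j x) * (x + Q.totalLength - Q.len j) ≤ ρ * Q.totalLength * x := by
  have h2 := len_lt_totalLength j
  rw [arcCdf_eq hρ j hx, forwardBound_eq hρ, le_div_iff₀ (by linarith)]
  constructor <;> intro <;> linarith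

theorem arcCdf_lt_iff (hρ : ∀ j, h.real (Q.branch j) = ρ * Q.len j) (j : Fin Q.n) {x : ℝ}
    (hx : 0 ≤ x) : arcCdf h j x < forwardBound h j x ↔
      h.real (Q.near j x) * (x + Q.totalLength - Q.len j) < ρ * Q.totalLength * x := by
  have h2 := len_lt_totalLength j
  rw [arcCdf_eq hρ j hx, forwardBound_eq hρ, lt_div_iff₀ (by linarith)]
  constructor <;> intro <;> linarith

theorem forwardBiased_iff (hρ : ∀ j, h.real (Q.branch j) = ρ * Q.len j) :
    ForwardBiased h ↔ ∀ j x, 0 ≤ x → x ≤ Q.len j →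
      h.real (Q.near j x) * (x + Q.totalLength - Q.len j) ≤ ρ * Q.totalLength * x :=
  forall₄_congr fun j _ hx _ => arcCdf_le_iff hρ j hx

theorem strictlyForwardBiased_iff (hρ : ∀ j, h.real (Q.branch j) = ρ * Q.len j) :
    StrictlyForwardBiased h ↔ ForwardBiased h ∧ ∀ j x, 0 < x → x < Q.len j →
      h.real (Q.near j x) * (x + Q.totalLength - Q.len j) < ρ * Q.totalLength * x :=
  and_congr_right fun _ => forall₄_congr fun j _ hx _ => arcCdf_lt_iff hρ j hx.le

end

/-! ### Necessity -/

theorem Search.AgreeUntilCovered.expectedTime_le {S S' : Q.Search} (hS : S.AgreeUntilCovered S')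
    (h : Measure Q.Point) : S'.expectedTime h ≤ S.expectedTime h := by
  obtain ⟨M, hM, hagree⟩ := hS
  refine lintegral_mono fun p => Search.le_time fun t ht => ?_
  rcases le_total t M with htM | htM
  · exact Search.time_le ((hagree t htM).symm.trans ht)
  · obtain ⟨u, hu, hup⟩ : p ∈ S.path '' Set.Icc 0 M := hM ▸ Set.mem_univ p
    exact (Search.time_le ((hagree u hu.2).symm.trans hup)).trans
      (ENNReal.coe_le_coe.2 (hu.2.trans htM))

theorem StronglySimplySearchable.simplySearchable {h : Measure Q.Point}
    (hs : StronglySimplySearchable h) :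
    SimplySearchable h := by
  obtain ⟨S, hS⟩ := Search.exists_isOptimal h
  obtain ⟨S', hS', hagree⟩ := hs S hS
  exact ⟨S', hS', fun T => (hagree.expectedTime_le h).trans (hS T)⟩

variable {h : Measure Q.Point} [IsFiniteMeasure h] {ρ : ℝ}

/-- If a depth-first search is optimal, an additional first excursion does not pay. -/
theorem SimplySearchable.near_le (hρ : ∀ j, h.real (Q.branch j) = ρ * Q.len j) (hρ0 : 0 ≤ ρ)
    (hs : SimplySearchable h) (j : Fin Q.n) {x : ℝ} (hx : 0 ≤ x) :
    h.real (Q.near j x) * (x + Q.totalLength - Q.len j) ≤ ρ * Q.totalLength * x := by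
  -- without mass off the root there is nothing to compare
  rcases hρ0.eq_or_lt with h0 | h0
  · have h1 : h.real (Q.near j x) = 0 := by
      refine le_antisymm ((measureReal_mono (near_subset_branch j x)).trans ?_) measureReal_nonneg
      rw [hρ, ← h0, zero_mul]
    rw [h1, ← h0, zero_mul, zero_mul, zero_mul]
  · obtain ⟨S, hS, hopt⟩ := hs
    obtain ⟨σ, hσ⟩ := Search.isDepthFirst_iff.1 hS
    lift x to ℝ≥0 using hx
    obtain ⟨S', hS'⟩ := exists_last_prepend hρ j x
    have h1 := (hopt _).trans hS'
    rw [hσ.expectedTime_eq hρ, ENNReal.add_le_add_iff_left (meanDist_ne_top h),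
      ENNReal.ofReal_le_ofReal_iff'] at h1
    rcases h1 with h1 | h1
    · linarith
    · exact absurd h1 (not_le.2 (mul_pos h0 Q.pairSum_pos))

theorem pt_ne_root {j : Fin Q.n} {s : ℝ} (h0 : 0 < s) (h1 : s ≤ Q.len j) : Q.pt j s ≠ Q.root := by
  intro hr
  have := dist_root_pt h0.le h1
  rw [hr, dist_self] at this
  linarith

theorem eq_of_pt_eq {i j : Fin Q.n} {s t : ℝ} (h0 : 0 < s) (h1 : s ≤ Q.len i)
    (h : Q.pt i s = Q.pt j t) : i = j := by
  by_contra hij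
  exact pt_ne_root h0 h1 (eq_root_of_mem_arc hij (pt_mem_arc i s) (h ▸ pt_mem_arc j t))

/-- A search that starts with an excursion to an inner point of an arc is not depth-first. -/
theorem not_agree_prepend (S : Q.Search) {j : Fin Q.n} {x : ℝ≥0} (hx0 : 0 < x)
    (hxl : (x : ℝ) < Q.len j) {S' : Q.Search} (hS' : S'.IsDepthFirst) :
    ¬ (S.prepend j x).AgreeUntilCovered S' := by
  rintro ⟨M, hM, hagree⟩
  obtain ⟨σ, hσ⟩ := Search.isDepthFirst_iff.1 hS'
  have hl := Q.len_pos j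
  have hx0' : (0 : ℝ) < x := hx0
  -- the leaf of arc `j` is reached after the first excursion
  have hxM : 2 * x ≤ M := by
    obtain ⟨u, hu, hup⟩ : Q.pt j (Q.len j) ∈ (S.prepend j x).path '' Set.Icc 0 M :=
      hM ▸ Set.mem_univ _
    refine le_trans ?_ hu.2
    by_contra hcon
    have hux : (u : ℝ) < 2 * x := by
      have : u < 2 * x := not_le.1 hcon
      exact_mod_cast this
    rw [Search.prepend_path_of_le _ _ _ hux.le] at hup
    have hmin : min (u : ℝ) (2 * x - u) ≤ x := by
      rcases le_total (u : ℝ) x with h | h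
      · exact (min_le_left _ _).trans h
      · exact (min_le_right _ _).trans (by linarith)
    have h0 : 0 ≤ min (u : ℝ) (2 * x - u) := le_min u.coe_nonneg (by linarith)
    have h1 := dist_root_pt h0 (hmin.trans hxl.le)
    rw [hup, dist_root_pt hl.le le_rfl] at h1
    linarith
  have hn := Q.two_le_n
  set k : Fin Q.n := ⟨0, by omega⟩ with hk
  have hk0 : tourStart σ k = 0 := by rw [← tourTime_coe]; exact tourTime_zero σ
  have hlk := Q.len_pos (σ k)
  -- the first tour takes place on arc `j`
  have hσk : σ k = j := by
    obtain ⟨t, ht⟩ : ∃ t : ℝ≥0, (t : ℝ) = min (x : ℝ) (Q.len (σ k)) :=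
      ⟨⟨_, le_min hx0'.le hlk.le⟩, rfl⟩
    have ht0 : (0 : ℝ) < t := ht ▸ lt_min hx0' hlk
    have htx : (t : ℝ) ≤ x := ht ▸ min_le_left _ _
    have htl : (t : ℝ) ≤ Q.len (σ k) := ht ▸ min_le_right _ _
    have htM : t ≤ M := by
      refine le_trans ?_ hxM
      rw [← NNReal.coe_le_coe]; push_cast; linarith
    have h1 := hagree t htM
    rw [Search.prepend_path_of_le _ _ _ (by linarith), min_eq_left (by linarith),
      hσ k t (by linarith) (by linarith), hk0, sub_zero, zero_add, min_eq_left (by linarith)] at h1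
    exact (eq_of_pt_eq ht0 (by linarith) h1).symm
  have h1 := hagree (2 * x) hxM
  have hc : ((2 * x : ℝ≥0) : ℝ) = 2 * x := by push_cast; rfl
  rw [Search.prepend_path_of_le _ _ _ hc.le, hc, sub_self, min_eq_right (by linarith), pt_zero,
    hσ k _ (by rw [hc]; linarith) (by rw [hc, hσk]; linarith), hk0, hc, hσk, sub_zero,
    zero_add] at h1
  rcases le_total (2 * (x : ℝ)) (2 * Q.len j - 2 * x) with h | h
  · rw [min_eq_left h] at h1
    exact pt_ne_root (by linarith) (by linarith) h1.symm
  · rw [min_eq_right h] at h1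
    exact pt_ne_root (by linarith) (by linarith) h1.symm

/-- If the forward bound is attained inside an arc, the search with an additional first excursion
is optimal too. -/
theorem StronglySimplySearchable.near_lt (hρ : ∀ j, h.real (Q.branch j) = ρ * Q.len j)
    (hs : StronglySimplySearchable h) (j : Fin Q.n) {x : ℝ} (hx : 0 < x) (hxl : x < Q.len j) :
    h.real (Q.near j x) * (x + Q.totalLength - Q.len j) < ρ * Q.totalLength * x := by
  by_contra hcon
  lift x to ℝ≥0 using hx.le
  obtain ⟨S, hS⟩ := exists_last_prepend hρ j x
  obtain ⟨S₁, hS₁, hopt⟩ := hs.simplySearchable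
  obtain ⟨σ, hσ⟩ := Search.isDepthFirst_iff.1 hS₁
  have hopt' : (S.prepend j x).IsOptimal h := fun T => by
    refine le_trans (hS.trans ?_) (hopt T)
    rw [hσ.expectedTime_eq hρ]
    exact add_le_add le_rfl (ENNReal.ofReal_le_ofReal (by linarith))
  obtain ⟨S', hS', hagree⟩ := hs _ hopt'
  exact not_agree_prepend S (NNReal.coe_pos.1 hx) hxl hS' hagree

end StarNetwork

end

theorem mainTheorem2 (Q : StarNetwork) (h : MeasureTheory.Measure Q.Point)
    [MeasureTheory.IsProbabilityMeasure h] (hbal : StarNetwork.Balanced h) :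
    (StarNetwork.SimplySearchable h ↔ StarNetwork.ForwardBiased h) ∧
      (StarNetwork.StronglySimplySearchable h ↔ StarNetwork.StrictlyForwardBiased h) := by
  obtain ⟨ρ, hρ0, hρ⟩ := hbal.exists_density
  refine ⟨⟨fun hs => ?_, fun hfb => ?_⟩, ⟨fun hs => ?_, fun hsfb S hS => ?_⟩⟩
  · exact (StarNetwork.forwardBiased_iff hρ).2 fun j x hx _ => hs.near_le hρ hρ0 j hx
  · obtain ⟨S, hS⟩ := StarNetwork.exists_follows (1 : Equiv.Perm (Fin Q.n))
    refine ⟨S, StarNetwork.Search.isDepthFirst_iff.2 ⟨1, hS⟩, fun T => ?_⟩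
    rw [hS.expectedTime_eq hρ]
    exact StarNetwork.Search.le_expectedTime hρ hρ0 ((StarNetwork.forwardBiased_iff hρ).1 hfb) T
  · refine (StarNetwork.strictlyForwardBiased_iff hρ).2
      ⟨(StarNetwork.forwardBiased_iff hρ).2 fun j x hx _ =>
        hs.simplySearchable.near_le hρ hρ0 j hx, fun j x hx hxl => hs.near_lt hρ j hx hxl⟩
  · obtain ⟨hfb, hlt⟩ := (StarNetwork.strictlyForwardBiased_iff hρ).1 hsfb
    have hpos : 0 < ρ := by
      refine hρ0.lt_of_ne fun h0 => ?_
      have hj : 0 < Q.n := by have := Q.two_le_n; omega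
      have hl := Q.len_pos ⟨0, hj⟩
      have hμ := StarNetwork.len_lt_totalLength (⟨0, hj⟩ : Fin Q.n)
      have h1 := hlt ⟨0, hj⟩ (Q.len ⟨0, hj⟩ / 2) (by linarith) (by linarith)
      rw [← h0, zero_mul, zero_mul] at h1
      exact absurd h1 (not_lt.2 (mul_nonneg MeasureTheory.measureReal_nonneg (by linarith)))
    obtain ⟨S₀, hS₀⟩ := StarNetwork.exists_follows (1 : Equiv.Perm (Fin Q.n))
    refine StarNetwork.Search.exists_agree hρ hpos
      ((StarNetwork.forwardBiased_iff hρ).1 hfb) hlt ?_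
    rw [← hS₀.expectedTime_eq hρ]
    exact hS S₀
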